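/- Notation. For a real matrix or vector, $|\cdot|$ is taken entrywise; $\mathrm{cond}_2(A)=\Vert\,|A^{-1}||A|\,\Vert_2$; $\tilde\gamma^f_n=\frac{c\,n\,u_f}{1-c\,n\,u_f}$. Computations are done in an arithmetic with unit roundoff $u_f$ obeying the standard model: each $+,-,\times,/,\sqrt{\ }$ is exact up to a relative error of at most $u_f$ (no overflow or underflow). Let $A\in\mathbb R^{n\times n}$ be nonsingular and $k\in\{1,\dots,n\}$. For a set $\mathcal J\subseteq\{1,\dots,n\}$ let $\mathcal I$ be the set of rows in which $A^T(:,\mathcal J)$ is nonzero. The computed column $\widehat m_k$ for pattern $\mathcal J$ is obtained by solving $\min\Vert e_k(\mathcal I)-A^T(\mathcal I,\mathcal J)\bar m\Vert_2$ in the given arithmetic by Householder QR and back substitution, and by setting the entries outside $\mathcal J$ to zero; it is defined if the computed triangular factor has no zero on its diagonal. Let $\widehat r_k=fl_{u_f}(e_k-A^T\widehat m_k)$ be the computed residual, and $r_k=e_k-A^Tm_k$, where $m_k$ is the exact minimizer of $\Vert e_k-A^Tm\Vert_2$ over the vectors $m$ supported in $\mathcal J$. Statement. There are absolute constants $c,C>0$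 such that, for all $n$ and all nonsingular $A\in\mathbb R^{n\times n}$: 1. (Residual bound, any pattern.) There are $K$ and $u_0>0$, depending only on $A$, such that for all $u_f\le u_0$, all $k$ and all $\mathcal J$, the computed column $\widehat m_k$ is defined and $$\Vert\widehat r_k\Vert_2\le n^2\tilde\gamma_n^f\,\big\Vert |e_k|+|A^T||\widehat m_k|\big\Vert_2+\big(1+n^2\tilde\gamma_n^f\,\mathrm{cond}_2(A)\big)\Vert r_k\Vert_2+K u_f^2 .$$ 2. (Full pattern.) For $\mathcal J=\{1,\dots,n\}$ one has $r_k=0$. If $c\,n^2u_f<1$ and $\widehat m_k$ is the computed column for the full pattern (assumed to be defined), then $$\Vert\widehat r_k\Vert_2\le n^2\tilde\gamma_n^f\,\big\Vert |e_k|+|A^T||\widehat m_k|\big\Vert_2 .$$ Hence, if $\varepsilon>0$ and $$n^2\tilde\gamma_n^f\,\big\Vert |e_k|+|A^T||\widehat m_k|\big\Vert_2\le\varepsilon, \qquad (*)$$ then $\Vert\widehat r_k\Vert_2\le\varepsilon$ for this column, and the stopping criterion is attained by every adaptive process: if $\mathcal J_0,\mathcal J_1,\dots$ are patterns such that $\mathcal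 J_{t}\subsetneq\mathcal J_{t+1}$ whenever $\mathcal J_t$ is not full, then for some $t\le n$ the column computed for $\mathcal J_t$ is defined and its computed residual has 2-norm at most $\varepsilon$. 3. (A priori condition.) Let $\varepsilon>0$. If $$C n^3\,u_f\,\mathrm{cond}_2(A)\le\min(\varepsilon,1),$$ or if, for some $\sigma$ with $\Vert a_i\Vert_2\le\sigma\Vert a_j\Vert_2$ for all columns $a_i,a_j$ of $A$, $$C n^4\,\sigma\,u_f\,\mathrm{cond}_2(A^T)\le\min(\varepsilon,1),$$ then the computed column $\widehat m_k$ for the full pattern is defined, $c\,n^2u_f<1$, $(*)$ holds, and $\Vert\widehat r_k\Vert_2\le\varepsilon$. -/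

import Mathlib

/-- A floating point arithmetic with unit roundoff `u` obeying the standard model (no overflow and
no underflow): every elementary operation returns the exact result up to a relative error of at
most `u`. Nothing is assumed on a division by zero or on the root of a negative number. -/
structure FloatArith (u : ℝ) where
  fadd : ℝ → ℝ → ℝ
  fsub : ℝ → ℝ → ℝ
  fmul : ℝ → ℝ → ℝ
  fdiv : ℝ → ℝ → ℝ
  fsqrt : ℝ → ℝ
  fadd_err : ∀ x y, |fadd x y - (x + y)| ≤ u * |x + y|
  fsub_err : ∀ x y, |fsub x y - (x - y)| ≤ u * |x - y|
  fmul_err : ∀ x y, |fmul x y - x * y| ≤ u * |x * y|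
  fdiv_err : ∀ x y, y ≠ 0 → |fdiv x y - x / y| ≤ u * |x / y|
  fsqrt_err : ∀ x, 0 ≤ x → |fsqrt x - Real.sqrt x| ≤ u * Real.sqrt x

/-- The Euclidean norm of a vector. -/
noncomputable def norm2 {n : ℕ} (v : Fin n → ℝ) : ℝ :=
  ‖(WithLp.toLp 2 v : EuclideanSpace ℝ (Fin n))‖

/-- The entrywise absolute value of a vector. -/
def absVec {n : ℕ} (v : Fin n → ℝ) : Fin n → ℝ := fun i => |v i|

/-- The entrywise absolute value of a matrix. -/
def absMat {m n : ℕ} (A : Matrix (Fin m) (Fin n) ℝ) : Matrix (Fin m) (Fin n) ℝ :=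
  fun i j => |A i j|

/-- `cond₂(A) = ‖ |A⁻¹| |A| ‖₂` (spectral norm), for nonsingular `A`. -/
noncomputable def cond2 {n : ℕ} (A : Matrix (Fin n) (Fin n) ℝ) : ℝ :=
  ‖Matrix.toEuclideanCLM (n := Fin n) (𝕜 := ℝ) (absMat A⁻¹ * absMat A)‖

/-- `γ̃_k = c k u / (1 - c k u)`. -/
noncomputable def gammaTilde (c u : ℝ) (k : ℕ) : ℝ := c * k * u / (1 - c * k * u)

/-- The `k`-th unit vector. -/
def unitVec {n : ℕ} (k : Fin n) : Fin n → ℝ := Pi.single k 1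

namespace FloatArith

variable {u : ℝ} (fl : FloatArith u)

/-- Computed inner product of the entries of `x` and `y` over the indices in `l`, accumulated in
the order of the list. -/
def dot {m : ℕ} (l : List (Fin m)) (x y : Fin m → ℝ) : ℝ :=
  l.foldl (fun acc i => fl.fadd acc (fl.fmul (x i) (y i))) 0

/-- The row indices `i ≥ d`, in increasing order. -/
def rowsFrom {p : ℕ} (d : Fin p) : List (Fin p) := (List.finRange p).filter (fun i => d ≤ i)

/-- Computed Euclidean norm of the part of `x` in the rows from `d` on. -/
def tailNorm {p : ℕ} (d : Fin p) (x : Fin p → ℝ) : ℝ := fl.fsqrt (fl.dot (rowsFrom d) x x)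

/-- Computed `s = sign(x_d) ‖x(d:p)‖₂`. -/
noncomputable def houseS {p : ℕ} (d : Fin p) (x : Fin p → ℝ) : ℝ :=
  if x d < 0 then -fl.tailNorm d x else fl.tailNorm d x

/-- Computed Householder vector (only its entries from `d` on are used): `v_d = x_d + s` and
`v_i = x_i` for `i > d`. -/
noncomputable def houseV {p : ℕ} (d : Fin p) (x : Fin p → ℝ) : Fin p → ℝ :=
  fun i => if i = d then fl.fadd (x d) (fl.houseS d x) else x i

/-- Computed `β = 1 / (s v_d)`; the reflector is `I - β v vᵀ`. -/
noncomputable def houseBeta {p : ℕ} (d : Fin p) (x : Fin p → ℝ) : ℝ :=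
  fl.fdiv 1 (fl.fmul (fl.houseS d x) (fl.houseV d x d))

/-- Computed application to `y` of the reflector that annihilates `x` below row `d`:
`y(d:p) - (β (vᵀ y)) v`. -/
noncomputable def houseApply {p : ℕ} (d : Fin p) (x y : Fin p → ℝ) : Fin p → ℝ :=
  fun i =>
    if d ≤ i then
      fl.fsub (y i)
        (fl.fmul (fl.fmul (fl.houseBeta d x) (fl.dot (rowsFrom d) (fl.houseV d x) y))
          (fl.houseV d x i))
    else y i

/-- One step of Householder QR: the reflector built from column `j` is applied to the later columns
of the matrix and to the right-hand side; in column `j` the diagonal entry becomes `-s` and the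
entries below it become zero. A column that vanishes from the diagonal on is left alone. -/
noncomputable def qrStep {p q : ℕ} (S : Matrix (Fin p) (Fin q) ℝ × (Fin p → ℝ)) (j : Fin q) :
    Matrix (Fin p) (Fin q) ℝ × (Fin p → ℝ) :=
  if h : j.1 < p then
    let d : Fin p := ⟨j.1, h⟩
    let x : Fin p → ℝ := fun i => S.1 i j
    if fl.tailNorm d x = 0 then S
    else
      (fun i l =>
          if l < j then S.1 i l
          else if l = j then
            (if i < d then S.1 i l else if i = d then -fl.houseS d x else 0)
          else fl.houseApply d x (fun i' => S.1 i' l) i,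
        fl.houseApply d x S.2)
  else S

/-- Householder QR of `M` with the transformations also applied to `b`: all steps, in order. -/
noncomputable def qrReduce {p q : ℕ} (M : Matrix (Fin p) (Fin q) ℝ) (b : Fin p → ℝ) :
    Matrix (Fin p) (Fin q) ℝ × (Fin p → ℝ) :=
  (List.finRange q).foldl fl.qrStep (M, b)

/-- Computed back substitution for the upper triangular system `R x = c`. -/
def backSub {q : ℕ} (R : Matrix (Fin q) (Fin q) ℝ) (c : Fin q → ℝ) : Fin q → ℝ :=
  (List.finRange q).reverse.foldl
    (fun x i =>
      Function.update x i
        (fl.fdiv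
          (((List.finRange q).filter (fun j => i < j)).foldl
            (fun acc j => fl.fsub acc (fl.fmul (R i j) (x j))) (c i))
          (R i i)))
    0

/-- The leading `q` entries of a vector of length `p` (padded by zeros if `p < q`). -/
def top {p : ℕ} (q : ℕ) (y : Fin p → ℝ) : Fin q → ℝ :=
  fun i => if h : i.1 < p then y ⟨i.1, h⟩ else 0

open Classical in
/-- Computed solution of `min ‖b - M x‖₂` by Householder QR and back substitution; `none` if the
computed triangular factor has a zero on its diagonal, so that back substitution breaks down. -/
noncomputable def leastSquares {p q : ℕ} (M : Matrix (Fin p) (Fin q) ℝ) (b : Fin p → ℝ) :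
    Option (Fin q → ℝ) :=
  let S := fl.qrReduce M b
  let R : Matrix (Fin q) (Fin q) ℝ := fun i j => top q (fun r => S.1 r j) i
  if ∀ i, R i i ≠ 0 then some (fl.backSub R (top q S.2)) else none

end FloatArith

open Classical in
/-- The shadow of a column index set `J`: the rows in which `B(:, J)` is not zero. -/
noncomputable def shadow {n : ℕ} (B : Matrix (Fin n) (Fin n) ℝ) (J : Finset (Fin n)) :
    Finset (Fin n) :=
  Finset.univ.filter fun i => ∑ j ∈ J, |B i j| ≠ 0

/-- The column computed for pattern `J`: with `I` the shadow of `J`, the reduced problem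
`min ‖e_k(I) - B(I, J) x‖₂` is solved by Householder QR in the arithmetic `fl`, and the result is
placed into the positions `J` of a vector that is zero elsewhere. -/
noncomputable def spaiColumn {u : ℝ} (fl : FloatArith u) {n : ℕ} (B : Matrix (Fin n) (Fin n) ℝ)
    (k : Fin n) (J : Finset (Fin n)) : Option (Fin n → ℝ) :=
  (fl.leastSquares
    (B.submatrix ((shadow B J).orderEmbOfFin rfl) (J.orderEmbOfFin rfl))
    (fun i => unitVec k ((shadow B J).orderEmbOfFin rfl i))).map
    fun x => Function.extend (J.orderEmbOfFin rfl) x 0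

/-- The computed residual `fl(e_k - B m)`. -/
noncomputable def spaiResidual {u : ℝ} (fl : FloatArith u) {n : ℕ} (B : Matrix (Fin n) (Fin n) ℝ)
    (k : Fin n) (m : Fin n → ℝ) : Fin n → ℝ :=
  fun i => fl.fsub (unitVec k i) (fl.dot (List.finRange n) (B i) m)

/-- `m` is an exact least-squares column for pattern `J`: it minimizes `‖e_k - B m‖₂` among the
vectors that vanish outside `J`. -/
def IsExactColumn {n : ℕ} (B : Matrix (Fin n) (Fin n) ℝ) (k : Fin n) (J : Finset (Fin n))
    (m : Fin n → ℝ) : Prop :=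
  (∀ j, j ∉ J → m j = 0) ∧
    ∀ m' : Fin n → ℝ, (∀ j, j ∉ J → m' j = 0) →
      norm2 (unitVec k - B.mulVec m) ≤ norm2 (unitVec k - B.mulVec m')

/-- `‖ |e_k| + |B| |m| ‖₂`. -/
noncomputable def dataSize {n : ℕ} (B : Matrix (Fin n) (Fin n) ℝ) (k : Fin n) (m : Fin n → ℝ) : ℝ :=
  norm2 (absVec (unitVec k) + (absMat B).mulVec (absVec m))

/-!
Householder QR followed by back substitution is columnwise backward stable, and the residual bounds
follow from this by elementary norm estimates.

A computed reflector, applied to a vector, differs from an exact reflector by a relative error of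
order `n u` (`FloatArith.norm2_houseApply_sub_le`): there is no cancellation in `v_d = x_d + s`, and
`β ‖v‖² = 2`. Hence the reduced matrix and right-hand side `(R, c)` are the image of the data
`(M, b)` under one norm-preserving linear map `Q`, up to a columnwise relative error `η` of order
`n² u` (`FloatArith.exists_isPerturbedImage_qrReduce`). All errors are measured after the
transformation, so that neither an inverse of `Q` nor a perturbed matrix `M + ΔM` is needed. The
back substitution leaves a small residual in the leading rows of `c - R x`
(`FloatArith.abs_sub_mulVec_backSub_le`). Both errors are bounded by
`‖b‖₂ + ∑ⱼ ‖M(:, j)‖₂ |xⱼ|`, which is at most `n ‖ |b| + |M| |x| ‖₂`.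

For the full pattern there are no trailing rows, and the bound on the residual is immediate
(`norm2_sub_mulVec_le_of_univ`). For an arbitrary pattern, the trailing rows of `c` do not involve
the unknowns, so that their norm is at most that of the exact residual, up to
`η (‖b‖₂ + ∑ⱼ ‖M(:, j)‖₂ |mⱼ|)` with the exact solution `m`
(`IsPerturbedImage.norm2_residual_le_add`). Replacing `m` by the computed solution costs
`η ∑ⱼ ‖M(:, j)‖₂ |mⱼ - xⱼ|`, which is `O(u²)` by a first order perturbation bound
(`IsPerturbedImage.norm2_sub_le_of_orthogonal`).

If a diagonal entry of `R` vanishes, then `R z = 0` for some `z ≠ 0`, so that `‖M z‖` is at most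
`η ∑ⱼ ‖M(:, j)‖₂ |zⱼ|`. Since `|w| ≤ |A⁻ᵀ| |Aᵀ w|` entrywise, `‖ |Aᵀ| |w| ‖₂ ≤ cond₂(A) ‖Aᵀ w‖₂`
(`norm2_absMat_mulVec_le_cond2`), which excludes this when `n³ u cond₂(A)` is small, and which also
bounds the data size `‖ |e_k| + |Aᵀ| |m| ‖₂` by a multiple of `cond₂(A)`. The condition on
`cond₂(Aᵀ)` reduces to the one on `cond₂(A)`, as `cond₂(A) ≤ n σ cond₂(Aᵀ)`
(`cond2_le_mul_cond2_transpose`).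
-/

/-! ### The Euclidean norm -/

theorem norm2_eq_sqrt {n : ℕ} (v : Fin n → ℝ) : norm2 v = Real.sqrt (∑ i, v i ^ 2) := by
  simp [norm2, EuclideanSpace.norm_eq]

theorem norm2_sq {n : ℕ} (v : Fin n → ℝ) : norm2 v ^ 2 = ∑ i, v i ^ 2 := by
  rw [norm2_eq_sqrt, Real.sq_sqrt (Finset.sum_nonneg fun i _ => sq_nonneg _)]

theorem norm2_nonneg {n : ℕ} (v : Fin n → ℝ) : 0 ≤ norm2 v := norm_nonneg _

theorem norm2_zero {n : ℕ} : norm2 (0 : Fin n → ℝ) = 0 := by simp [norm2]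

theorem norm2_add_le {n : ℕ} (v w : Fin n → ℝ) : norm2 (v + w) ≤ norm2 v + norm2 w := by
  simpa [norm2] using norm_add_le (WithLp.toLp 2 v : EuclideanSpace ℝ (Fin n)) (WithLp.toLp 2 w)

theorem norm2_neg {n : ℕ} (v : Fin n → ℝ) : norm2 (-v) = norm2 v := by
  simp [norm2_eq_sqrt]

theorem norm2_sub_le {n : ℕ} (v w : Fin n → ℝ) : norm2 (v - w) ≤ norm2 v + norm2 w := by
  rw [sub_eq_add_neg, ← norm2_neg w]
  exact norm2_add_le _ _

theorem norm2_smul {n : ℕ} (a : ℝ) (v : Fin n → ℝ) : norm2 (a • v) = |a| * norm2 v := by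
  simpa [norm2] using norm_smul a (WithLp.toLp 2 v : EuclideanSpace ℝ (Fin n))

theorem norm2_sum_le {n : ℕ} {ι : Type*} (s : Finset ι) (f : ι → Fin n → ℝ) :
    norm2 (∑ i ∈ s, f i) ≤ ∑ i ∈ s, norm2 (f i) := by
  classical
  induction s using Finset.induction_on with
  | empty => simp [norm2_zero]
  | insert a s ha ih =>
    rw [Finset.sum_insert ha, Finset.sum_insert ha]
    exact (norm2_add_le _ _).trans (by gcongr)

theorem norm2_le_norm2 {n : ℕ} {v w : Fin n → ℝ} (h : ∀ i, |v i| ≤ |w i|) :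
    norm2 v ≤ norm2 w := by
  rw [norm2_eq_sqrt, norm2_eq_sqrt]
  exact Real.sqrt_le_sqrt (Finset.sum_le_sum fun i _ => sq_le_sq.mpr (h i))

theorem norm2_absVec {n : ℕ} (v : Fin n → ℝ) : norm2 (absVec v) = norm2 v := by
  simp [norm2_eq_sqrt, absVec]

theorem abs_le_norm2 {n : ℕ} (v : Fin n → ℝ) (i : Fin n) : |v i| ≤ norm2 v := by
  apply abs_le_of_sq_le_sq _ (norm2_nonneg v)
  rw [norm2_sq]
  exact Finset.single_le_sum (f := fun i => v i ^ 2) (fun j _ => sq_nonneg _) (Finset.mem_univ i)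

theorem norm2_le_sum_abs {n : ℕ} (v : Fin n → ℝ) : norm2 v ≤ ∑ i, |v i| := by
  apply le_of_sq_le_sq _ (Finset.sum_nonneg fun i _ => abs_nonneg _)
  rw [norm2_sq]
  calc ∑ i, v i ^ 2 = ∑ i, |v i| ^ 2 := by simp
    _ ≤ (∑ i, |v i|) ^ 2 := Finset.sum_sq_le_sq_sum_of_nonneg fun i _ => abs_nonneg _

theorem sum_abs_le_card_mul_norm2 {n : ℕ} (v : Fin n → ℝ) : ∑ i, |v i| ≤ n * norm2 v := by
  calc ∑ i, |v i| ≤ ∑ _i : Fin n, norm2 v := Finset.sum_le_sum fun i _ => abs_le_norm2 v i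
    _ = n * norm2 v := by simp

theorem eq_zero_of_norm2_eq_zero {n : ℕ} {v : Fin n → ℝ} (h : norm2 v = 0) : v = 0 := by
  funext i
  have := abs_le_norm2 v i
  rw [h] at this
  exact abs_nonpos_iff.mp this

theorem sum_mul_le_norm2_mul {n : ℕ} (v w : Fin n → ℝ) :
    ∑ i, |v i| * |w i| ≤ norm2 v * norm2 w := by
  apply le_of_sq_le_sq _ (mul_nonneg (norm2_nonneg _) (norm2_nonneg _))
  rw [mul_pow, norm2_sq, norm2_sq]
  simpa using Finset.sum_mul_sq_le_sq_mul_sq Finset.univ (fun i => |v i|) (fun i => |w i|)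

theorem dotProduct_le_norm2_mul {n : ℕ} (v w : Fin n → ℝ) :
    v ⬝ᵥ w ≤ norm2 v * norm2 w := by
  refine le_trans (Finset.sum_le_sum fun i _ => ?_) (sum_mul_le_norm2_mul v w)
  rw [← abs_mul]
  exact le_abs_self _

theorem norm2_sq_eq_dotProduct {n : ℕ} (v : Fin n → ℝ) : norm2 v ^ 2 = v ⬝ᵥ v := by
  rw [norm2_sq]
  exact Finset.sum_congr rfl fun i _ => sq _

/-- A linear map that preserves the Euclidean norm preserves the inner product (polarization). -/
theorem dotProduct_map_map {p q : ℕ} (Q : (Fin p → ℝ) →ₗ[ℝ] (Fin q → ℝ))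
    (hQ : ∀ y, norm2 (Q y) = norm2 y) (v w : Fin p → ℝ) : Q v ⬝ᵥ Q w = v ⬝ᵥ w := by
  have polar : ∀ {m : ℕ} (x y : Fin m → ℝ),
      2 * (x ⬝ᵥ y) = norm2 (x + y) ^ 2 - norm2 x ^ 2 - norm2 y ^ 2 := by
    intro m x y
    simp only [norm2_sq_eq_dotProduct, add_dotProduct, dotProduct_add, dotProduct_comm y x]
    ring
  have h1 := polar (Q v) (Q w)
  rw [← map_add, hQ, hQ, hQ, ← polar v w] at h1
  linarith

/-! ### Accumulated rounding errors -/

theorem one_add_pow_sub_one_le {u : ℝ} (hu : 0 ≤ u) (k : ℕ) (h : k * u ≤ 1) :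
    (1 + u) ^ k - 1 ≤ 2 * (k * u) := by
  have h1 : (1 + u) ^ k ≤ Real.exp (k * u) := by
    rw [Real.exp_nat_mul]
    gcongr
    linarith [Real.add_one_le_exp u]
  have h0 : 0 ≤ k * u := by positivity
  have h2 := Real.abs_exp_sub_one_le (x := k * u) (by rw [abs_of_nonneg h0]; exact h)
  rw [abs_of_nonneg h0] at h2
  linarith [le_abs_self (Real.exp (k * u) - 1)]

theorem one_add_pow_sub_one_le_four_mul {u : ℝ} (hu : 0 ≤ u) {m n : ℕ} (hm : m ≤ n)
    (hn : 1 ≤ n) (h : n * u ≤ 1 / 100) :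
    (1 + u) ^ m - 1 ≤ 4 * (n * u) ∧ (1 + u) ^ (m + 1) - 1 ≤ 4 * (n * u) := by
  have hm' : (m : ℝ) ≤ n := by exact_mod_cast hm
  have hn' : (1 : ℝ) ≤ n := by exact_mod_cast hn
  have h1 : ((m + 1 : ℕ) : ℝ) * u ≤ 2 * (n * u) := by
    push_cast
    nlinarith
  have h2 := one_add_pow_sub_one_le hu (m + 1) (by linarith)
  have h3 : (1 + u) ^ m ≤ (1 + u) ^ (m + 1) := pow_le_pow_right₀ (by linarith) (by omega)
  constructor <;> linarith

/-- Error of a product of two approximated factors. -/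
theorem abs_mul_sub_mul_le {a a' b b' α β S T : ℝ} (ha : |a' - a| ≤ α * S) (hb : |b' - b| ≤ β * T)
    (hS : |a| ≤ S) (hT : |b| ≤ T) (hα : 0 ≤ α) :
    |a' * b' - a * b| ≤ (α + β + α * β) * (S * T) := by
  have h : a' * b' - a * b = (a' - a) * b + a * (b' - b) + (a' - a) * (b' - b) := by ring
  have hS0 : 0 ≤ S := (abs_nonneg _).trans hS
  have hT0 : 0 ≤ T := (abs_nonneg _).trans hT
  calc |a' * b' - a * b|
      ≤ |a' - a| * |b| + |a| * |b' - b| + |a' - a| * |b' - b| := by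
        rw [h, ← abs_mul, ← abs_mul, ← abs_mul]
        exact abs_add_three _ _ _
    _ ≤ (α * S) * T + S * (β * T) + (α * S) * (β * T) := by gcongr
    _ = _ := by ring

/-- Error of a floating point accumulation `a + t₁ + t₂ + ⋯`, in which each step
approximates the sum with relative error `u` and the term with relative error `u` too. -/
theorem abs_foldl_sub_le {ι : Type*} {u : ℝ} (hu : 0 ≤ u) (f : ℝ → ι → ℝ) (t : ι → ℝ)
    (hf : ∀ a i, |f a i - (a + t i)| ≤ u * |a| + ((1 + u) ^ 2 - 1) * |t i|) (l : List ι) :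
    ∀ a, |l.foldl f a - (a + (l.map t).sum)| ≤
      ((1 + u) ^ l.length - 1) * |a| +
        ((1 + u) ^ (l.length + 1) - 1) * (l.map fun i => |t i|).sum := by
  induction l with
  | nil => intro a; simp
  | cons i l ih =>
    intro a
    have hsum : 0 ≤ (l.map fun i => |t i|).sum := by
      apply List.sum_nonneg
      simp only [List.mem_map]
      rintro _ ⟨j, _, rfl⟩
      exact abs_nonneg _
    simp only [List.foldl_cons, List.map_cons, List.sum_cons, List.length_cons]
    set G := (1 + u) ^ l.length with hG
    have hG1 : 1 ≤ G := one_le_pow₀ (by linarith)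
    have h1 := hf a i
    have h2 := ih (f a i)
    have h3 : |f a i| ≤ (1 + u) * |a| + (1 + u) ^ 2 * |t i| := by
      calc |f a i| = |(f a i - (a + t i)) + a + t i| := by congr 1; ring
        _ ≤ |f a i - (a + t i)| + |a| + |t i| := abs_add_three _ _ _
        _ ≤ _ := by linarith
    calc |l.foldl f (f a i) - (a + (t i + (l.map t).sum))|
        = |(l.foldl f (f a i) - (f a i + (l.map t).sum)) + (f a i - (a + t i))| := by
          congr 1; ring
      _ ≤ |l.foldl f (f a i) - (f a i + (l.map t).sum)| + |f a i - (a + t i)| := abs_add_le _ _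
      _ ≤ ((G - 1) * ((1 + u) * |a| + (1 + u) ^ 2 * |t i|) +
            (G * (1 + u) - 1) * (l.map fun i => |t i|).sum) +
            (u * |a| + ((1 + u) ^ 2 - 1) * |t i|) := by
          have : (G - 1) * |f a i| ≤ (G - 1) * ((1 + u) * |a| + (1 + u) ^ 2 * |t i|) :=
            mul_le_mul_of_nonneg_left h3 (by linarith)
          have h4 : (1 + u) ^ (l.length + 1) = G * (1 + u) := by rw [pow_succ]
          rw [h4] at h2
          linarith
      _ ≤ _ := by
          have h4 : (1 + u) ^ (l.length + 1) = G * (1 + u) := by rw [pow_succ]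
          have h5 : (1 + u) ^ (l.length + 1 + 1) = G * (1 + u) ^ 2 := by
            rw [pow_succ, h4]; ring
          rw [h4, h5]
          nlinarith [mul_nonneg (mul_nonneg (zero_le_one.trans hG1) hu)
            (mul_nonneg hsum (by linarith : 0 ≤ 1 + u))]

theorem sum_map_filter_finRange {p : ℕ} (P : Fin p → Prop) [DecidablePred P] (f : Fin p → ℝ) :
    (((List.finRange p).filter fun i => P i).map f).sum = ∑ i, if P i then f i else 0 := by
  rw [Fin.sum_univ_def]
  generalize List.finRange p = l
  induction l with
  | nil => simp
  | cons a l ih => by_cases h : P a <;> simp [h, ih]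

namespace FloatArith

variable {u : ℝ} (fl : FloatArith u)

theorem unitRoundoff_nonneg {u : ℝ} (fl : FloatArith u) : 0 ≤ u := by
  have h := (abs_nonneg _).trans (fl.fadd_err 1 0)
  simpa using h

theorem abs_fadd_fmul_sub_le (a x y : ℝ) :
    |fl.fadd a (fl.fmul x y) - (a + x * y)| ≤ u * |a| + ((1 + u) ^ 2 - 1) * |x * y| := by
  have hu := fl.unitRoundoff_nonneg
  have h1 := fl.fadd_err a (fl.fmul x y)
  have h2 := fl.fmul_err x y
  have h3 : |a + fl.fmul x y| ≤ |a| + (1 + u) * |x * y| := by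
    calc |a + fl.fmul x y| = |a + x * y + (fl.fmul x y - x * y)| := by congr 1; ring
      _ ≤ |a| + |x * y| + |fl.fmul x y - x * y| := abs_add_three _ _ _
      _ ≤ _ := by linarith
  calc |fl.fadd a (fl.fmul x y) - (a + x * y)|
      = |(fl.fadd a (fl.fmul x y) - (a + fl.fmul x y)) + (fl.fmul x y - x * y)| := by
        congr 1; ring
    _ ≤ u * |a + fl.fmul x y| + u * |x * y| := (abs_add_le _ _).trans (add_le_add h1 h2)
    _ ≤ u * (|a| + (1 + u) * |x * y|) + u * |x * y| := by gcongr
    _ = _ := by ring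

theorem abs_fsub_fmul_sub_le (a x y : ℝ) :
    |fl.fsub a (fl.fmul x y) - (a + -(x * y))| ≤ u * |a| + ((1 + u) ^ 2 - 1) * |-(x * y)| := by
  have hu := fl.unitRoundoff_nonneg
  have h1 := fl.fsub_err a (fl.fmul x y)
  have h2 := fl.fmul_err x y
  rw [abs_neg]
  have h3 : |a - fl.fmul x y| ≤ |a| + (1 + u) * |x * y| := by
    calc |a - fl.fmul x y| = |a + -(x * y) + -(fl.fmul x y - x * y)| := by congr 1; ring
      _ ≤ |a| + |-(x * y)| + |-(fl.fmul x y - x * y)| := abs_add_three _ _ _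
      _ ≤ _ := by rw [abs_neg, abs_neg]; linarith
  calc |fl.fsub a (fl.fmul x y) - (a + -(x * y))|
      = |(fl.fsub a (fl.fmul x y) - (a - fl.fmul x y)) + -(fl.fmul x y - x * y)| := by
        congr 1; ring
    _ ≤ u * |a - fl.fmul x y| + u * |x * y| :=
        (abs_add_le _ _).trans (add_le_add h1 (by rwa [abs_neg]))
    _ ≤ u * (|a| + (1 + u) * |x * y|) + u * |x * y| := by gcongr
    _ = _ := by ring

/-- Rounding error of an inner product over the indices that satisfy `P`. -/
theorem abs_dot_sub_le {p n : ℕ} (hp : p ≤ n) (hn : 1 ≤ n) (h : n * u ≤ 1 / 100)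
    (P : Fin p → Prop) [DecidablePred P] (x y : Fin p → ℝ) :
    |fl.dot ((List.finRange p).filter fun i => P i) x y - ∑ i, if P i then x i * y i else 0| ≤
      4 * (n * u) * ∑ i, if P i then |x i * y i| else 0 := by
  have hu := fl.unitRoundoff_nonneg
  have h1 := abs_foldl_sub_le hu (fun acc i => fl.fadd acc (fl.fmul (x i) (y i)))
    (fun i => x i * y i) (fun a i => fl.abs_fadd_fmul_sub_le a (x i) (y i))
    ((List.finRange p).filter fun i => P i) 0
  rw [sum_map_filter_finRange, sum_map_filter_finRange, abs_zero, mul_zero, zero_add,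
    zero_add] at h1
  refine h1.trans (mul_le_mul_of_nonneg_right ?_ ?_)
  · refine (one_add_pow_sub_one_le_four_mul hu ?_ hn h).2
    exact ((List.length_filter_le _ _).trans (by simp)).trans hp
  · exact Finset.sum_nonneg fun i _ => by split_ifs <;> positivity

end FloatArith

/-! ### Exact Householder reflectors -/

/-- The part of `x` in the rows from `d` on, padded by zeros. -/
def tailPart {p : ℕ} (d : Fin p) (x : Fin p → ℝ) : Fin p → ℝ := fun i => if d ≤ i then x i else 0

/-- The exact value `s = sign(x_d) ‖x(d:p)‖₂`. -/
noncomputable def reflectorS {p : ℕ} (d : Fin p) (x : Fin p → ℝ) : ℝ :=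
  if x d < 0 then -norm2 (tailPart d x) else norm2 (tailPart d x)

/-- The exact Householder vector, padded by zeros above row `d`. -/
noncomputable def reflectorV {p : ℕ} (d : Fin p) (x : Fin p → ℝ) : Fin p → ℝ :=
  fun i => if i = d then x d + reflectorS d x else tailPart d x i

/-- The exact scaling factor `β = 1 / (s v_d)`; it is `0` if `x` vanishes from row `d` on. -/
noncomputable def reflectorBeta {p : ℕ} (d : Fin p) (x : Fin p → ℝ) : ℝ :=
  1 / (reflectorS d x * reflectorV d x d)

/-- The exact Householder reflector `y ↦ y - β (vᵀ y) v` that annihilates `x` below row `d`;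
it is the identity if `x` vanishes from row `d` on. -/
noncomputable def reflector {p : ℕ} (d : Fin p) (x : Fin p → ℝ) :
    (Fin p → ℝ) →ₗ[ℝ] (Fin p → ℝ) where
  toFun y := y - (reflectorBeta d x * (reflectorV d x ⬝ᵥ y)) • reflectorV d x
  map_add' y z := by
    rw [dotProduct_add]
    module
  map_smul' a y := by
    rw [dotProduct_smul, RingHom.id_apply, smul_eq_mul]
    module

section Reflector

variable {p : ℕ} (d : Fin p) (x : Fin p → ℝ)

theorem reflector_apply (y : Fin p → ℝ) : reflector d x y =
    y - (reflectorBeta d x * (reflectorV d x ⬝ᵥ y)) • reflectorV d x := rfl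

theorem abs_reflectorS : |reflectorS d x| = norm2 (tailPart d x) := by
  unfold reflectorS
  split_ifs <;> simp [abs_of_nonneg (norm2_nonneg _)]

theorem reflectorV_self : reflectorV d x d = x d + reflectorS d x := by simp [reflectorV]

/-- There is no cancellation in `v_d = x_d + s`. -/
theorem abs_reflectorV_self : |reflectorV d x d| = |x d| + norm2 (tailPart d x) := by
  have h0 := norm2_nonneg (tailPart d x)
  rw [reflectorV_self]
  unfold reflectorS
  split_ifs with h
  · rw [abs_of_neg h, abs_of_nonpos (by linarith)]; ring
  · push Not at h
    rw [abs_of_nonneg h, abs_of_nonneg (by linarith)]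

theorem reflectorS_mul_reflectorV :
    reflectorS d x * reflectorV d x d = norm2 (tailPart d x) * |reflectorV d x d| := by
  rw [abs_reflectorV_self, reflectorV_self]
  unfold reflectorS
  split_ifs with h
  · rw [abs_of_neg h]; ring
  · push Not at h
    rw [abs_of_nonneg h]

theorem reflectorV_dotProduct_self : reflectorV d x ⬝ᵥ x = reflectorS d x * reflectorV d x d := by
  have h1 : reflectorV d x = tailPart d x + reflectorS d x • Pi.single d 1 := by
    funext i
    by_cases hi : i = d
    · subst hi; simp [reflectorV, tailPart]
    · simp [reflectorV, hi]
  have h2 : tailPart d x ⬝ᵥ x = norm2 (tailPart d x) ^ 2 := by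
    rw [norm2_sq]
    refine Finset.sum_congr rfl fun i _ => ?_
    by_cases hi : d ≤ i <;> simp [tailPart, hi, sq]
  have h3 : norm2 (tailPart d x) ^ 2 = reflectorS d x ^ 2 := by
    rw [← abs_reflectorS, sq_abs]
  rw [reflectorV_self, h1, add_dotProduct, h2, h3, smul_dotProduct]
  simp
  ring

theorem norm2_reflectorV_sq :
    norm2 (reflectorV d x) ^ 2 = 2 * (reflectorS d x * reflectorV d x d) := by
  have h1 : reflectorV d x ⬝ᵥ reflectorV d x =
      reflectorV d x ⬝ᵥ x + reflectorV d x d * reflectorS d x := by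
    have : ∀ i, reflectorV d x i * reflectorV d x i =
        reflectorV d x i * x i + if i = d then reflectorV d x d * reflectorS d x else 0 := by
      intro i
      by_cases hi : i = d
      · subst hi
        rw [if_pos rfl, reflectorV_self]; ring
      · by_cases hd : d ≤ i <;> simp [reflectorV, tailPart, hi, hd]
    unfold dotProduct
    rw [Finset.sum_congr rfl fun i _ => this i, Finset.sum_add_distrib]
    simp
  rw [norm2_sq_eq_dotProduct, h1, reflectorV_dotProduct_self]
  ring

theorem norm2_reflector (y : Fin p → ℝ) : norm2 (reflector d x y) = norm2 y := by
  rw [← sq_eq_sq₀ (norm2_nonneg _) (norm2_nonneg _), norm2_sq_eq_dotProduct,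
    norm2_sq_eq_dotProduct, reflector_apply]
  set b := reflectorBeta d x with hb
  set v := reflectorV d x with hv
  have h1 : v ⬝ᵥ v = 2 * (reflectorS d x * v d) := by
    rw [← norm2_sq_eq_dotProduct, hv, norm2_reflectorV_sq]
  have h2 : b * (b * (v ⬝ᵥ v)) = 2 * b := by
    rw [h1, hb, reflectorBeta, ← hv]
    by_cases h : reflectorS d x * v d = 0
    · simp [h]
    · field_simp
  simp only [sub_dotProduct, dotProduct_sub, smul_dotProduct, dotProduct_smul, smul_eq_mul,
    dotProduct_comm y v]
  linear_combination (v ⬝ᵥ y) ^ 2 * h2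

variable {d x}

theorem reflectorS_mul_reflectorV_pos (h : norm2 (tailPart d x) ≠ 0) :
    0 < reflectorS d x * reflectorV d x d := by
  have h0 := (norm2_nonneg (tailPart d x)).lt_of_ne' h
  rw [reflectorS_mul_reflectorV, abs_reflectorV_self]
  positivity

theorem reflector_self (h : norm2 (tailPart d x) ≠ 0) (i : Fin p) :
    reflector d x x i = if i < d then x i else if i = d then -reflectorS d x else 0 := by
  have h0 := reflectorS_mul_reflectorV_pos h
  rw [reflector_apply, reflectorV_dotProduct_self, reflectorBeta, one_div_mul_cancel h0.ne',
    one_smul, Pi.sub_apply]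
  rcases lt_trichotomy i d with hi | hi | hi
  · simp [hi, hi.ne, reflectorV, tailPart, not_le.mpr hi]
  · subst hi; simp [reflectorV]
  · simp [hi.not_gt, hi.ne', reflectorV, tailPart, hi.le]

theorem reflector_eq_self {y : Fin p → ℝ} (hy : ∀ i, d ≤ i → y i = 0) : reflector d x y = y := by
  have : reflectorV d x ⬝ᵥ y = 0 := by
    refine Finset.sum_eq_zero fun i _ => ?_
    by_cases hd : d ≤ i
    · rw [hy i hd, mul_zero]
    · have : i ≠ d := fun h => hd h.ge
      simp [reflectorV, tailPart, hd, this]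
  rw [reflector_apply, this]
  simp

end Reflector

/-! ### Rounding errors of a computed Householder transformation -/

/-- If `a'` approximates `a` up to `α S` and `f` is `a'` after one rounding, the relative errors
compound. -/
theorem abs_sub_le_of_rounded {u α S a a' f : ℝ} (hu : 0 ≤ u) (ha : |a' - a| ≤ α * S)
    (hS : |a| ≤ S) (hf : |f - a'| ≤ u * |a'|) : |f - a| ≤ (α + u * (1 + α)) * S := by
  have h1 : |a'| ≤ (1 + α) * S := by
    calc |a'| = |(a' - a) + a| := by congr 1; ring
      _ ≤ |a' - a| + |a| := abs_add_le _ _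
      _ ≤ _ := by linarith
  calc |f - a| = |(f - a') + (a' - a)| := by congr 1; ring
    _ ≤ |f - a'| + |a' - a| := abs_add_le _ _
    _ ≤ u * ((1 + α) * S) + α * S := by
      have := mul_le_mul_of_nonneg_left h1 hu
      linarith
    _ = _ := by ring

/-- Products of quantities of size `n u` are negligible, so that the relative errors below can be
added up with small integer constants. -/
theorem mul_le_of_small {u e : ℝ} (hu : 0 ≤ u) (hue : u ≤ e) (he : e ≤ 1 / 1000) :
    e * e ≤ e / 1000 ∧ u * e ≤ e / 1000 ∧ u * (e * e) ≤ e / 1000 := by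
  have h1 : e * e ≤ e / 1000 := by nlinarith
  have h2 : u * e ≤ e / 1000 := by nlinarith
  exact ⟨h1, h2, by nlinarith⟩

theorem abs_le_of_abs_sub_le {α S a a' : ℝ} (ha : |a' - a| ≤ α * S) (hS : |a| ≤ S) :
    |a'| ≤ (1 + α) * S := by
  calc |a'| = |(a' - a) + a| := by congr 1; ring
    _ ≤ |a' - a| + |a| := abs_add_le _ _
    _ ≤ _ := by linarith

theorem abs_sqrt_sub_le {a s α : ℝ} (hs : 0 ≤ s) (hα : α ≤ 1) (h : |a - s ^ 2| ≤ α * s ^ 2) :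
    0 ≤ a ∧ |Real.sqrt a - s| ≤ α * s := by
  have ha : 0 ≤ a := by nlinarith [(abs_le.mp h).1, sq_nonneg s]
  refine ⟨ha, ?_⟩
  rcases hs.eq_or_lt with h0 | h0
  · subst h0
    have : a = 0 := by
      have h1 : |a| ≤ 0 := by simpa using h
      exact abs_nonpos_iff.mp h1
    simp [this]
  · have h1 : |Real.sqrt a - s| * (Real.sqrt a + s) = |a - s ^ 2| := by
      rw [← abs_of_nonneg (by positivity : 0 ≤ Real.sqrt a + s), ← abs_mul]
      congr 1
      nlinarith [Real.sq_sqrt ha]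
    have h2 : |Real.sqrt a - s| * s ≤ α * s * s := by
      calc |Real.sqrt a - s| * s ≤ |Real.sqrt a - s| * (Real.sqrt a + s) := by
            gcongr
            linarith [Real.sqrt_nonneg a]
        _ ≤ _ := by rw [h1]; linarith
    exact le_of_mul_le_mul_right h2 h0

namespace FloatArith

section Householder

variable {u : ℝ} (fl : FloatArith u) {p n : ℕ} (d : Fin p) (x : Fin p → ℝ)

theorem unitRoundoff_le {u : ℝ} (fl : FloatArith u) {n : ℕ} (hn : 1 ≤ n) : u ≤ n * u := by
  have hu := fl.unitRoundoff_nonneg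
  have hn' : (1 : ℝ) ≤ n := by exact_mod_cast hn
  nlinarith

theorem abs_tailNorm_sub_le (hp : p ≤ n) (hn : 1 ≤ n) (h : n * u ≤ 1 / 1000) :
    |fl.tailNorm d x - norm2 (tailPart d x)| ≤ 6 * (n * u) * norm2 (tailPart d x) := by
  have hu := fl.unitRoundoff_nonneg
  have hun := fl.unitRoundoff_le hn
  have h1 := fl.abs_dot_sub_le hp hn (by linarith) (fun i => d ≤ i) x x
  have h2 : (∑ i, if d ≤ i then x i * x i else 0) = norm2 (tailPart d x) ^ 2 := by
    rw [norm2_sq]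
    refine Finset.sum_congr rfl fun i _ => ?_
    by_cases hi : d ≤ i <;> simp [tailPart, hi, sq]
  simp only [abs_mul_self] at h1
  rw [h2] at h1
  obtain ⟨h3, h4⟩ := abs_sqrt_sub_le (norm2_nonneg _) (by linarith) h1
  have h5 := abs_sub_le_of_rounded hu h4 (abs_of_nonneg (norm2_nonneg _)).le
    ((fl.fsqrt_err _ h3).trans_eq (by rw [abs_of_nonneg (Real.sqrt_nonneg _)]))
  refine h5.trans (mul_le_mul_of_nonneg_right ?_ (norm2_nonneg _))
  nlinarith

theorem norm2_tailPart_eq_zero (hp : p ≤ n) (hn : 1 ≤ n) (h : n * u ≤ 1 / 1000)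
    (h0 : fl.tailNorm d x = 0) : norm2 (tailPart d x) = 0 := by
  have h1 := fl.abs_tailNorm_sub_le d x hp hn h
  have h2 := norm2_nonneg (tailPart d x)
  rw [h0, zero_sub, abs_neg, abs_of_nonneg h2] at h1
  nlinarith

theorem norm2_tailPart_ne_zero (hp : p ≤ n) (hn : 1 ≤ n) (h : n * u ≤ 1 / 1000)
    (h0 : fl.tailNorm d x ≠ 0) : norm2 (tailPart d x) ≠ 0 := by
  intro h2
  have h1 := fl.abs_tailNorm_sub_le d x hp hn h
  rw [h2, sub_zero, mul_zero] at h1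
  exact h0 (abs_nonpos_iff.mp h1)

theorem abs_houseS_sub_le (hp : p ≤ n) (hn : 1 ≤ n) (h : n * u ≤ 1 / 1000) :
    |fl.houseS d x - reflectorS d x| ≤ 6 * (n * u) * norm2 (tailPart d x) := by
  have h1 := fl.abs_tailNorm_sub_le d x hp hn h
  unfold houseS reflectorS
  split_ifs
  · rw [← abs_neg]
    convert h1 using 2
    ring
  · exact h1

theorem abs_houseV_sub_le (hp : p ≤ n) (hn : 1 ≤ n) (h : n * u ≤ 1 / 1000) {i : Fin p}
    (hi : d ≤ i) :
    |fl.houseV d x i - reflectorV d x i| ≤ 8 * (n * u) * |reflectorV d x i| := by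
  have hu := fl.unitRoundoff_nonneg
  have hun := fl.unitRoundoff_le hn
  by_cases hid : i = d
  · subst hid
    have h1 := fl.abs_houseS_sub_le i x hp hn h
    have h2 : norm2 (tailPart i x) ≤ |reflectorV i x i| := by
      rw [abs_reflectorV_self]
      linarith [abs_nonneg (x i)]
    have h3 : |(x i + fl.houseS i x) - reflectorV i x i| ≤
        6 * (n * u) * |reflectorV i x i| := by
      rw [reflectorV_self]
      rw [reflectorV_self] at h2
      calc |(x i + fl.houseS i x) - (x i + reflectorS i x)|
          = |fl.houseS i x - reflectorS i x| := by congr 1; ring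
        _ ≤ 6 * (n * u) * norm2 (tailPart i x) := h1
        _ ≤ _ := by gcongr
    have h4 := abs_sub_le_of_rounded hu h3 le_rfl (fl.fadd_err (x i) (fl.houseS i x))
    have h5 : fl.houseV i x i = fl.fadd (x i) (fl.houseS i x) := by simp [houseV]
    rw [h5]
    refine h4.trans (mul_le_mul_of_nonneg_right ?_ (abs_nonneg _))
    nlinarith
  · have : fl.houseV d x i = reflectorV d x i := by
      simp [houseV, reflectorV, tailPart, hid, hi]
    rw [this, sub_self, abs_zero]
    have : 0 ≤ n * u := by linarith
    positivity

theorem abs_houseBeta_sub_le (hp : p ≤ n) (hn : 1 ≤ n) (h : n * u ≤ 1 / 1000)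
    (h0 : norm2 (tailPart d x) ≠ 0) :
    |fl.houseBeta d x - reflectorBeta d x| ≤ 20 * (n * u) * reflectorBeta d x := by
  have hu := fl.unitRoundoff_nonneg
  have hun := fl.unitRoundoff_le hn
  have hw := reflectorS_mul_reflectorV_pos h0
  have h1 := abs_mul_sub_mul_le (fl.abs_houseS_sub_le d x hp hn h)
    (fl.abs_houseV_sub_le d x hp hn h le_rfl) (abs_reflectorS d x).le le_rfl (by linarith)
  rw [← reflectorS_mul_reflectorV] at h1
  have h2 := abs_sub_le_of_rounded hu h1 (abs_of_pos hw).le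
    (fl.fmul_err (fl.houseS d x) (fl.houseV d x d))
  unfold houseBeta reflectorBeta
  set w := reflectorS d x * reflectorV d x d
  set w' := fl.fmul (fl.houseS d x) (fl.houseV d x d)
  set e := n * u
  have he : 0 ≤ e := hu.trans hun
  obtain ⟨he1, he2, he3⟩ := mul_le_of_small hu hun h
  have h3 : |w' - w| ≤ 17 * e * w := by
    refine h2.trans (mul_le_mul_of_nonneg_right ?_ hw.le)
    linarith
  have h4 : 98 / 100 * w ≤ w' := by nlinarith [(abs_le.mp h3).1]
  have hw' : 0 < w' := by linarith
  have h5 : |1 / w' - 1 / w| ≤ 18 * e * (1 / w) := by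
    have : 1 / w' - 1 / w = -((w' - w) / (w' * w)) := by field_simp; ring
    rw [this, abs_neg, abs_div, abs_of_pos (mul_pos hw' hw), div_le_iff₀ (mul_pos hw' hw)]
    calc |w' - w| ≤ 17 * e * w := h3
      _ ≤ 18 * e * w' := by nlinarith
      _ = _ := by field_simp
  have h6 : |1 / w| ≤ 1 / w := (abs_of_pos (by positivity)).le
  have h7 := abs_sub_le_of_rounded hu h5 h6 (fl.fdiv_err 1 w' hw'.ne')
  refine h7.trans (mul_le_mul_of_nonneg_right ?_ (by positivity))
  nlinarith

theorem abs_houseApply_sub_le (hp : p ≤ n) (hn : 1 ≤ n) (h : n * u ≤ 1 / 1000)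
    (h0 : norm2 (tailPart d x) ≠ 0) (y : Fin p → ℝ) (i : Fin p) :
    |fl.houseApply d x y i - reflector d x y i| ≤
      n * u * |y i| + 49 * (n * u) *
        (reflectorBeta d x * (∑ j, |reflectorV d x j| * |y j|) * |reflectorV d x i|) := by
  have hu := fl.unitRoundoff_nonneg
  have hun := fl.unitRoundoff_le hn
  have hβ := fl.abs_houseBeta_sub_le d x hp hn h h0
  have hβ0 : 0 ≤ reflectorBeta d x :=
    (one_div_pos.mpr (reflectorS_mul_reflectorV_pos h0)).le
  rw [reflector_apply, Pi.sub_apply, Pi.smul_apply, smul_eq_mul]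
  set v := reflectorV d x with hv
  set T := ∑ j, |v j| * |y j| with hT
  set b := reflectorBeta d x with hb
  set e := n * u with he
  have he0 : 0 ≤ e := hu.trans hun
  have hT0 : 0 ≤ T := Finset.sum_nonneg fun j _ => by positivity
  by_cases hi : d ≤ i
  · rw [houseApply, if_pos hi]
    -- the computed inner product of the computed Householder vector with `y`
    have hD : |fl.dot (rowsFrom d) (fl.houseV d x) y - v ⬝ᵥ y| ≤ 13 * e * T := by
      have h1 := fl.abs_dot_sub_le hp hn (by linarith) (fun i => d ≤ i) (fl.houseV d x) y
      have h2 : ∀ j, |(if d ≤ j then fl.houseV d x j * y j else 0) - v j * y j| ≤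
          8 * e * (|v j| * |y j|) := by
        intro j
        by_cases hj : d ≤ j
        · rw [if_pos hj, ← sub_mul, abs_mul, ← mul_assoc]
          exact mul_le_mul_of_nonneg_right (fl.abs_houseV_sub_le d x hp hn h hj) (abs_nonneg _)
        · have h3 : v j = 0 := by
            have : j ≠ d := fun h => hj h.ge
            simp [hv, reflectorV, tailPart, hj, this]
          simp [hj, h3]
      have h3 : (∑ j, if d ≤ j then |fl.houseV d x j * y j| else 0) ≤ (1 + 8 * e) * T := by
        rw [hT, Finset.mul_sum]
        refine Finset.sum_le_sum fun j _ => ?_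
        have := abs_le_of_abs_sub_le (h2 j) (abs_mul _ _).le
        by_cases hj : d ≤ j
        · simpa [hj] using this
        · simp only [hj, if_false]; positivity
      have h4 : |(∑ j, if d ≤ j then fl.houseV d x j * y j else 0) - v ⬝ᵥ y| ≤ 8 * e * T := by
        unfold dotProduct
        rw [← Finset.sum_sub_distrib, hT, Finset.mul_sum]
        exact (Finset.abs_sum_le_sum_abs _ _).trans (Finset.sum_le_sum fun j _ => h2 j)
      have h5 : 4 * e * (∑ j, if d ≤ j then |fl.houseV d x j * y j| else 0) ≤
          4 * e * ((1 + 8 * e) * T) := by gcongr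
      have h6 := (abs_sub_le _ _ (v ⬝ᵥ y)).trans (add_le_add (h1.trans h5) h4)
      refine h6.trans ?_
      rw [← mul_assoc, ← add_mul]
      refine mul_le_mul_of_nonneg_right ?_ hT0
      nlinarith
    have hvy : |v ⬝ᵥ y| ≤ T := by
      refine (Finset.abs_sum_le_sum_abs _ _).trans (Finset.sum_le_sum fun j _ => ?_)
      rw [abs_mul]
    have h1 := abs_mul_sub_mul_le hβ hD (abs_of_nonneg hβ0).le hvy (by positivity)
    have hbv : |b * (v ⬝ᵥ y)| ≤ b * T := by
      rw [abs_mul, abs_of_nonneg hβ0]; gcongr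
    have h2 := abs_sub_le_of_rounded hu h1 hbv (fl.fmul_err _ _)
    set z := fl.fmul (fl.houseBeta d x) (fl.dot (rowsFrom d) (fl.houseV d x) y)
    obtain ⟨he1, he2, he3⟩ := mul_le_of_small hu hun h
    have h3 : |z - b * (v ⬝ᵥ y)| ≤ 36 * e * (b * T) := by
      refine h2.trans (mul_le_mul_of_nonneg_right ?_ (by positivity))
      linarith
    have h4 := abs_mul_sub_mul_le h3 (fl.abs_houseV_sub_le d x hp hn h hi) hbv le_rfl
      (by positivity)
    rw [← he, ← hv] at h4
    have hbvv : |b * (v ⬝ᵥ y) * v i| ≤ b * T * |v i| := by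
      rw [abs_mul]; gcongr
    have h5 := abs_sub_le_of_rounded hu h4 hbvv (fl.fmul_err _ _)
    set w := fl.fmul z (fl.houseV d x i)
    set W := b * T * |v i| with hW
    have hW0 : 0 ≤ W := by positivity
    have h6 : |w - b * (v ⬝ᵥ y) * v i| ≤ 47 * e * W := by
      refine h5.trans (mul_le_mul_of_nonneg_right ?_ hW0)
      linarith
    have h7 : |y i - w| ≤ |y i| + (1 + 47 * e) * W := by
      exact (abs_sub _ _).trans (add_le_add le_rfl (abs_le_of_abs_sub_le h6 hbvv))
    calc |fl.fsub (y i) w - (y i - b * (v ⬝ᵥ y) * v i)|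
        = |(fl.fsub (y i) w - (y i - w)) + -(w - b * (v ⬝ᵥ y) * v i)| := by congr 1; ring
      _ ≤ u * |y i - w| + 47 * e * W :=
        (abs_add_le _ _).trans (add_le_add (fl.fsub_err _ _) (by rwa [abs_neg]))
      _ ≤ e * (|y i| + (1 + 47 * e) * W) + 47 * e * W := by gcongr
      _ ≤ _ := by nlinarith [mul_nonneg he0 hW0]
  · have h3 : v i = 0 := by
      have : i ≠ d := fun h => hi h.ge
      simp [hv, reflectorV, tailPart, hi, this]
    rw [houseApply, if_neg hi, h3]
    simp only [mul_zero, sub_zero, sub_self, abs_zero, add_zero]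
    positivity

/-- The computed application of a reflector has a small normwise error, relative to the exact
reflector: the error is of order `n u`, as `β ‖v‖² = 2`. -/
theorem norm2_houseApply_sub_le (hp : p ≤ n) (hn : 1 ≤ n) (h : n * u ≤ 1 / 1000)
    (h0 : norm2 (tailPart d x) ≠ 0) (y : Fin p → ℝ) :
    norm2 (fl.houseApply d x y - reflector d x y) ≤ 100 * (n * u) * norm2 y := by
  have hu := fl.unitRoundoff_nonneg
  have hun := fl.unitRoundoff_le hn
  have hw := reflectorS_mul_reflectorV_pos h0
  have hβ0 : 0 ≤ reflectorBeta d x := (one_div_pos.mpr hw).le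
  have hβ : reflectorBeta d x * norm2 (reflectorV d x) ^ 2 = 2 := by
    rw [norm2_reflectorV_sq, reflectorBeta, one_div_mul_eq_div, mul_div_cancel_right₀ _ hw.ne']
  have h1 := fl.abs_houseApply_sub_le d x hp hn h h0 y
  have hT := sum_mul_le_norm2_mul (reflectorV d x) y
  set T := ∑ j, |reflectorV d x j| * |y j| with hTd
  set b := reflectorBeta d x with hb
  set e := n * u with he
  have he0 : 0 ≤ e := hu.trans hun
  have hT0 : 0 ≤ T := Finset.sum_nonneg fun j _ => by positivity
  have h2 : norm2 (fl.houseApply d x y - reflector d x y) ≤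
      norm2 (e • absVec y + (49 * e * (b * T)) • absVec (reflectorV d x)) := by
    refine norm2_le_norm2 fun i => ?_
    refine le_trans ((h1 i).trans_eq ?_) (le_abs_self _)
    simp only [Pi.add_apply, Pi.smul_apply, absVec, smul_eq_mul]
    ring
  refine h2.trans ((norm2_add_le _ _).trans ?_)
  rw [norm2_smul, norm2_smul, norm2_absVec, norm2_absVec, abs_of_nonneg he0,
    abs_of_nonneg (by positivity)]
  have h3 : b * T * norm2 (reflectorV d x) ≤ 2 * norm2 y := by
    calc b * T * norm2 (reflectorV d x)
        ≤ b * (norm2 (reflectorV d x) * norm2 y) * norm2 (reflectorV d x) := by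
          have := norm2_nonneg (reflectorV d x)
          gcongr
      _ = (b * norm2 (reflectorV d x) ^ 2) * norm2 y := by ring
      _ = _ := by rw [hβ]
  have h4 := norm2_nonneg y
  nlinarith [mul_le_mul_of_nonneg_left h3 he0, mul_nonneg he0 h4]

end Householder

end FloatArith

/-! ### Backward error of Householder QR -/

/-- `(R, c)` is obtained from `(M, b)` by the norm-preserving linear map `Q`, up to an error that is
at most `η` relative to the norm of the right-hand side and of each column. -/
structure IsPerturbedImage {p q : ℕ} (η : ℝ) (Q : (Fin p → ℝ) →ₗ[ℝ] (Fin p → ℝ))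
    (M : Matrix (Fin p) (Fin q) ℝ) (b : Fin p → ℝ) (R : Matrix (Fin p) (Fin q) ℝ)
    (c : Fin p → ℝ) : Prop where
  norm2_map : ∀ y, norm2 (Q y) = norm2 y
  col : ∀ l, norm2 ((fun i => R i l) - Q fun i => M i l) ≤ η * norm2 fun i => M i l
  rhs : norm2 (c - Q b) ≤ η * norm2 b

theorem norm2_sub_map_trans {p : ℕ} {η₁ η₂ : ℝ} (hη₂ : 0 ≤ η₂)
    {P Q : (Fin p → ℝ) →ₗ[ℝ] (Fin p → ℝ)} (hP : ∀ y, norm2 (P y) = norm2 y)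
    (hQ : ∀ y, norm2 (Q y) = norm2 y) {x y z : Fin p → ℝ}
    (h₁ : norm2 (y - Q x) ≤ η₁ * norm2 x) (h₂ : norm2 (z - P y) ≤ η₂ * norm2 y) :
    norm2 (z - P (Q x)) ≤ ((1 + η₁) * (1 + η₂) - 1) * norm2 x := by
  have hy : norm2 y ≤ (1 + η₁) * norm2 x := by
    calc norm2 y = norm2 ((y - Q x) + Q x) := by rw [sub_add_cancel]
      _ ≤ norm2 (y - Q x) + norm2 (Q x) := norm2_add_le _ _
      _ ≤ _ := by rw [hQ]; linarith
  calc norm2 (z - P (Q x)) = norm2 ((z - P y) + P (y - Q x)) := by rw [map_sub]; abel_nf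
    _ ≤ norm2 (z - P y) + norm2 (P (y - Q x)) := norm2_add_le _ _
    _ ≤ η₂ * ((1 + η₁) * norm2 x) + η₁ * norm2 x := by
      rw [hP]
      exact add_le_add (h₂.trans (mul_le_mul_of_nonneg_left hy hη₂)) h₁
    _ = _ := by ring

theorem IsPerturbedImage.trans {p q : ℕ} {η₁ η₂ : ℝ} (hη₂ : 0 ≤ η₂)
    {P Q : (Fin p → ℝ) →ₗ[ℝ] (Fin p → ℝ)} {M M' M'' : Matrix (Fin p) (Fin q) ℝ}
    {b b' b'' : Fin p → ℝ} (h₁ : IsPerturbedImage η₁ Q M b M' b')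
    (h₂ : IsPerturbedImage η₂ P M' b' M'' b'') :
    IsPerturbedImage ((1 + η₁) * (1 + η₂) - 1) (P ∘ₗ Q) M b M'' b'' where
  norm2_map y := by rw [LinearMap.comp_apply, h₂.norm2_map, h₁.norm2_map]
  col l := norm2_sub_map_trans hη₂ h₂.norm2_map h₁.norm2_map (h₁.col l) (h₂.col l)
  rhs := norm2_sub_map_trans hη₂ h₂.norm2_map h₁.norm2_map h₁.rhs h₂.rhs

theorem IsPerturbedImage.refl {p q : ℕ} {η : ℝ} (hη : 0 ≤ η) (M : Matrix (Fin p) (Fin q) ℝ)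
    (b : Fin p → ℝ) : IsPerturbedImage η LinearMap.id M b M b where
  norm2_map y := rfl
  col l := by
    rw [LinearMap.id_apply, sub_self, norm2_zero]
    exact mul_nonneg hη (norm2_nonneg _)
  rhs := by
    rw [LinearMap.id_apply, sub_self, norm2_zero]
    exact mul_nonneg hη (norm2_nonneg _)

theorem norm2_tailPart_le {p : ℕ} (d : Fin p) (x : Fin p → ℝ) :
    norm2 (tailPart d x) ≤ norm2 x := by
  refine norm2_le_norm2 fun i => ?_
  by_cases h : d ≤ i <;> simp [tailPart, h]

namespace FloatArith

section QR

variable {u : ℝ} (fl : FloatArith u) {p q n : ℕ}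

/-- One step of Householder QR is a reflection up to a columnwise relative error of order `n u`. -/
theorem exists_isPerturbedImage_qrStep (hp : p ≤ n) (hn : 1 ≤ n) (h : n * u ≤ 1 / 1000)
    (S : Matrix (Fin p) (Fin q) ℝ × (Fin p → ℝ)) (j : Fin q)
    (hS : ∀ (i : Fin p) (l : Fin q), l < j → l.1 < i.1 → S.1 i l = 0) :
    (∃ P, IsPerturbedImage (100 * (n * u)) P S.1 S.2 (fl.qrStep S j).1 (fl.qrStep S j).2) ∧
      ∀ (i : Fin p) (l : Fin q), l ≤ j → l.1 < i.1 → (fl.qrStep S j).1 i l = 0 := by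
  have hu := fl.unitRoundoff_nonneg
  have hη : 0 ≤ 100 * (n * u) := by positivity
  by_cases hj : j.1 < p
  · set d : Fin p := ⟨j.1, hj⟩ with hd
    set x : Fin p → ℝ := fun i => S.1 i j with hx
    by_cases h0 : fl.tailNorm d x = 0
    · have hstep : fl.qrStep S j = S := by simp [qrStep, hj, ← hd, ← hx, h0]
      rw [hstep]
      refine ⟨⟨_, IsPerturbedImage.refl hη _ _⟩, fun i l hl hi => ?_⟩
      rcases hl.lt_or_eq with hl | rfl
      · exact hS i l hl hi
      · have h1 := eq_zero_of_norm2_eq_zero (fl.norm2_tailPart_eq_zero d x hp hn h h0)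
        have hdi : d ≤ i := Fin.le_def.mpr hi.le
        simpa [tailPart, hdi] using congrFun h1 i
    · have hstep : fl.qrStep S j = (fun i l =>
          if l < j then S.1 i l
          else if l = j then
            (if i < d then S.1 i l else if i = d then -fl.houseS d x else 0)
          else fl.houseApply d x (fun i' => S.1 i' l) i, fl.houseApply d x S.2) := by
        rw [qrStep, dif_pos hj]
        exact if_neg h0
      have hσ := fl.norm2_tailPart_ne_zero d x hp hn h h0
      rw [hstep]
      refine ⟨⟨reflector d x, norm2_reflector d x, fun l => ?_,
        fl.norm2_houseApply_sub_le d x hp hn h hσ S.2⟩, fun i l hl hi => ?_⟩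
      · rcases lt_trichotomy l j with hl | rfl | hl
        · rw [reflector_eq_self]
          · simp only [hl, if_true]
            change norm2 ((fun i => S.1 i l) - fun i => S.1 i l) ≤ _
            rw [sub_self, norm2_zero]
            exact mul_nonneg hη (norm2_nonneg _)
          · intro i hi
            exact hS i l hl (lt_of_lt_of_le (Fin.lt_def.mp hl) (Fin.le_def.mp hi))
        · simp only [lt_irrefl, if_false, if_true]
          change norm2 ((fun i => if i < d then x i else if i = d then -fl.houseS d x else 0) -
            reflector d x x) ≤ _
          have hs := fl.abs_houseS_sub_le d x hp hn h
          -- in the pivot column only the diagonal entry is computed, the others are set exactly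
          have h1 : norm2 ((fun i => if i < d then x i else if i = d then -fl.houseS d x else 0) -
              reflector d x x) ≤ 6 * (n * u) * norm2 (tailPart d x) := by
            refine (norm2_le_sum_abs _).trans ?_
            rw [Finset.sum_eq_single d]
            · rw [Pi.sub_apply, reflector_self hσ]
              simp only [lt_irrefl, if_false, if_true]
              rw [neg_sub_neg, abs_sub_comm]
              exact hs
            · intro i _ hi
              rw [Pi.sub_apply, reflector_self hσ]
              simp [hi]
            · simp
          refine h1.trans ?_
          have h2 := norm2_tailPart_le d x
          have h3 := norm2_nonneg (tailPart d x)
          have h4 : 6 * (n * u) ≤ 100 * (n * u) := by nlinarith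
          exact mul_le_mul h4 h2 h3 hη
        · simp only [hl.not_gt, hl.ne', if_false]
          exact fl.norm2_houseApply_sub_le d x hp hn h hσ _
      · rcases hl.lt_or_eq with hl | rfl
        · simp only [hl, if_true]
          exact hS i l hl hi
        · have h1 : ¬ i < d := fun hlt => absurd (Fin.lt_def.mp hlt) (by simp [hd]; omega)
          have h2 : i ≠ d := fun he => by simp [he, hd] at hi
          simp [h1, h2]
  · have hstep : fl.qrStep S j = S := by simp [qrStep, hj]
    rw [hstep]
    refine ⟨⟨_, IsPerturbedImage.refl hη _ _⟩, fun i l hl hi => ?_⟩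
    rcases hl.lt_or_eq with hl | rfl
    · exact hS i l hl hi
    · exact absurd i.2 (by omega)

theorem exists_isPerturbedImage_foldl_qrStep (hp : p ≤ n) (hn : 1 ≤ n) (h : n * u ≤ 1 / 1000)
    (M : Matrix (Fin p) (Fin q) ℝ) (b : Fin p → ℝ) (k : ℕ) (hk : k ≤ q) :
    let S := ((List.finRange q).take k).foldl fl.qrStep (M, b)
    (∃ Q, IsPerturbedImage ((1 + 100 * (n * u)) ^ k - 1) Q M b S.1 S.2) ∧
      ∀ (i : Fin p) (l : Fin q), l.1 < k → l.1 < i.1 → S.1 i l = 0 := by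
  have hu := fl.unitRoundoff_nonneg
  induction k with
  | zero =>
    refine ⟨⟨LinearMap.id, ?_⟩, fun i l hl => absurd hl (by simp)⟩
    simpa using IsPerturbedImage.refl le_rfl M b
  | succ k ih =>
    obtain ⟨⟨Q, hQ⟩, hz⟩ := ih (by omega)
    have htake : (List.finRange q).take (k + 1) =
        (List.finRange q).take k ++ [(⟨k, by omega⟩ : Fin q)] := by
      rw [List.take_succ_eq_append_getElem (by simpa using hk)]
      simp
    rw [htake, List.foldl_append]
    simp only [List.foldl_cons, List.foldl_nil]
    set S := ((List.finRange q).take k).foldl fl.qrStep (M, b)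
    obtain ⟨⟨P, hP⟩, hz'⟩ := fl.exists_isPerturbedImage_qrStep hp hn h S ⟨k, by omega⟩
      (fun i l hl hi => hz i l hl hi)
    refine ⟨⟨P ∘ₗ Q, ?_⟩, fun i l hl hi => hz' i l (Fin.le_def.mpr (by simp; omega)) hi⟩
    have := hQ.trans (by positivity) hP
    convert this using 1
    ring

/-- Householder QR is an orthogonal transformation of the data up to a columnwise relative error
of order `n² u`, and the computed factor is upper trapezoidal. -/
theorem exists_isPerturbedImage_qrReduce (hp : p ≤ n) (hq : q ≤ n) (hn : 1 ≤ n)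
    (h : n * (n * u) ≤ 1 / 1000) (M : Matrix (Fin p) (Fin q) ℝ) (b : Fin p → ℝ) :
    (∃ Q, IsPerturbedImage (200 * (n * (n * u))) Q M b (fl.qrReduce M b).1 (fl.qrReduce M b).2) ∧
      ∀ (i : Fin p) (l : Fin q), l.1 < i.1 → (fl.qrReduce M b).1 i l = 0 := by
  have hu := fl.unitRoundoff_nonneg
  have hn' : (1 : ℝ) ≤ n := by exact_mod_cast hn
  have hq' : (q : ℝ) ≤ n := by exact_mod_cast hq
  have he : 0 ≤ n * u := by positivity
  have h1 : n * u ≤ n * (n * u) := by nlinarith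
  obtain ⟨⟨Q, hQ⟩, hz⟩ :=
    fl.exists_isPerturbedImage_foldl_qrStep hp hn (by linarith) M b q le_rfl
  have htake : (List.finRange q).take q = List.finRange q := by
    rw [List.take_of_length_le]; simp
  rw [htake] at hQ hz
  have hqe : q * (100 * (n * u)) ≤ 100 * (n * (n * u)) := by nlinarith
  have hη := one_add_pow_sub_one_le (u := 100 * (n * u)) (by positivity) q (by linarith)
  have hη' : (1 + 100 * (n * u)) ^ q - 1 ≤ 200 * (n * (n * u)) := by linarith
  exact ⟨⟨Q, hQ.norm2_map,
    fun l => (hQ.col l).trans (mul_le_mul_of_nonneg_right hη' (norm2_nonneg _)),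
    hQ.rhs.trans (mul_le_mul_of_nonneg_right hη' (norm2_nonneg _))⟩, fun i l hi => hz i l l.2 hi⟩

end QR

end FloatArith

/-! ### Back substitution -/

theorem foldl_update_apply_of_notMem {ι α : Type*} [DecidableEq ι] (F : ι → (ι → α) → α)
    (l : List ι) (x : ι → α) {j : ι} (hj : j ∉ l) :
    l.foldl (fun x i => Function.update x i (F i x)) x j = x j := by
  induction l generalizing x with
  | nil => rfl
  | cons i l ih =>
    rw [List.mem_cons, not_or] at hj
    rw [List.foldl_cons, ih _ hj.2, Function.update_of_ne hj.1]

/-- If the entries are overwritten in decreasing order and the new entry `i` depends only on the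
entries after `i`, then every new entry is given by the final vector. -/
theorem foldl_update_apply_of_mem {ι α : Type*} [LinearOrder ι] (F : ι → (ι → α) → α)
    (hF : ∀ i x y, (∀ j, i < j → x j = y j) → F i x = F i y) (l : List ι)
    (hl : l.Pairwise (· > ·)) (x : ι → α) {i : ι} (hi : i ∈ l) :
    l.foldl (fun x i => Function.update x i (F i x)) x i =
      F i (l.foldl (fun x i => Function.update x i (F i x)) x) := by
  induction l generalizing x with
  | nil => simp at hi
  | cons k l ih =>
    rw [List.pairwise_cons] at hl
    rw [List.foldl_cons]
    rcases List.mem_cons.mp hi with rfl | hi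
    · have hil : i ∉ l := fun h => lt_irrefl i (hl.1 i h)
      rw [foldl_update_apply_of_notMem F l _ hil, Function.update_self]
      refine hF i _ _ fun j hj => ?_
      have hjl : j ∉ l := fun h => lt_asymm hj (hl.1 j h)
      rw [foldl_update_apply_of_notMem F l _ hjl, Function.update_of_ne hj.ne']
    · exact ih hl.2 _ hi

namespace FloatArith

section BackSub

variable {u : ℝ} (fl : FloatArith u) {q n : ℕ}

theorem backSub_apply (R : Matrix (Fin q) (Fin q) ℝ) (c : Fin q → ℝ) (i : Fin q) :
    fl.backSub R c i = fl.fdiv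
      (((List.finRange q).filter (fun j => i < j)).foldl
        (fun acc j => fl.fsub acc (fl.fmul (R i j) (fl.backSub R c j))) (c i)) (R i i) := by
  refine foldl_update_apply_of_mem (fun i x => fl.fdiv
      (((List.finRange q).filter (fun j => i < j)).foldl
        (fun acc j => fl.fsub acc (fl.fmul (R i j) (x j))) (c i)) (R i i))
    (fun i x y hxy => ?_) _ ?_ 0 (List.mem_reverse.mpr (List.mem_finRange i))
  · congr 1
    refine List.foldl_ext _ _ _ fun a j hj => ?_
    rw [hxy j (by simpa using hj)]
  · exact List.pairwise_reverse.mpr (List.pairwise_lt_finRange q)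

/-- Residual of the computed solution of an upper triangular system. -/
theorem abs_sub_mulVec_backSub_le (hq : q ≤ n) (hn : 1 ≤ n) (h : n * u ≤ 1 / 1000)
    (R : Matrix (Fin q) (Fin q) ℝ) (hR : ∀ i j, j < i → R i j = 0) (hd : ∀ i, R i i ≠ 0)
    (c : Fin q → ℝ) (i : Fin q) :
    |c i - R.mulVec (fl.backSub R c) i| ≤
      6 * (n * u) * (|c i| + ∑ j, |R i j| * |fl.backSub R c j|) := by
  have hu := fl.unitRoundoff_nonneg
  have hun := fl.unitRoundoff_le hn
  have hx := fl.backSub_apply R c i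
  set x := fl.backSub R c
  set l := (List.finRange q).filter (fun j => i < j) with hl
  set acc := l.foldl (fun acc j => fl.fsub acc (fl.fmul (R i j) (x j))) (c i)
  set W := |c i| + ∑ j, |R i j| * |x j| with hW
  have hW0 : 0 ≤ W := add_nonneg (abs_nonneg _) (Finset.sum_nonneg fun j _ => by positivity)
  have h1 := abs_foldl_sub_le hu (fun acc j => fl.fsub acc (fl.fmul (R i j) (x j)))
    (fun j => -(R i j * x j)) (fun a j => fl.abs_fsub_fmul_sub_le a (R i j) (x j)) l (c i)
  have hlen : l.length ≤ n := ((List.length_filter_le _ _).trans (by simp)).trans hq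
  obtain ⟨h2, h3⟩ := one_add_pow_sub_one_le_four_mul hu hlen hn (by linarith)
  rw [hl, sum_map_filter_finRange, sum_map_filter_finRange, ← hl] at h1
  simp only [abs_neg, abs_mul] at h1
  set e := n * u
  have he : 0 ≤ e := hu.trans hun
  obtain ⟨he1, he2, he3⟩ := mul_le_of_small hu hun h
  have hT : (∑ j, if i < j then |R i j| * |x j| else 0) ≤ ∑ j, |R i j| * |x j| := by
    refine Finset.sum_le_sum fun j _ => ?_
    split_ifs
    · exact le_rfl
    · positivity
  have hT0 : 0 ≤ ∑ j, if i < j then |R i j| * |x j| else 0 :=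
    Finset.sum_nonneg fun j _ => by split_ifs <;> positivity
  set s := ∑ j, if i < j then -(R i j * x j) else 0 with hs
  have h4 : |acc - (c i + s)| ≤ 4 * e * W := by
    refine h1.trans ?_
    rw [hW, mul_add]
    refine add_le_add (mul_le_mul_of_nonneg_right h2 (abs_nonneg _)) ?_
    exact mul_le_mul h3 hT hT0 (by positivity)
  have hsW : |c i + s| ≤ W := by
    refine (abs_add_le _ _).trans (add_le_add le_rfl ((Finset.abs_sum_le_sum_abs _ _).trans ?_))
    refine Finset.sum_le_sum fun j _ => ?_
    split_ifs
    · rw [abs_neg, abs_mul]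
    · rw [abs_zero]; positivity
  have h5 : |R i i * x i - acc| ≤ u * |acc| := by
    have h6 := mul_le_mul_of_nonneg_left (fl.fdiv_err acc (R i i) (hd i)) (abs_nonneg (R i i))
    rw [← hx, ← abs_mul, mul_sub, mul_div_cancel₀ _ (hd i)] at h6
    refine h6.trans_eq ?_
    rw [abs_div]
    have := abs_pos.mpr (hd i)
    field_simp
  have h6 := abs_sub_le_of_rounded hu h4 hsW h5
  have h7 : R.mulVec x i = R i i * x i - s := by
    have h8 : ∀ j, R i j * x j =
        (if j = i then R i i * x i else 0) - if i < j then -(R i j * x j) else 0 := by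
      intro j
      rcases lt_trichotomy j i with hj | rfl | hj
      · simp [hj.ne, hj.not_gt, hR i j hj]
      · simp
      · simp [hj.ne', hj]
    change ∑ j, R i j * x j = _
    rw [Finset.sum_congr rfl fun j _ => h8 j, Finset.sum_sub_distrib]
    simp [hs]
  calc |c i - R.mulVec x i| = |R i i * x i - (c i + s)| := by
        rw [h7, ← abs_neg]; congr 1; ring
    _ ≤ _ := h6
    _ ≤ _ := mul_le_mul_of_nonneg_right (by linarith) hW0

end BackSub

end FloatArith

theorem exists_mulVec_eq_zero_of_diag_eq_zero {q : ℕ} (R : Matrix (Fin q) (Fin q) ℝ)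
    (hR : ∀ i j, j < i → R i j = 0) {i : Fin q} (hi : R i i = 0) :
    ∃ z, z ≠ 0 ∧ R.mulVec z = 0 := by
  rw [Matrix.exists_mulVec_eq_zero_iff,
    Matrix.det_of_isUpperTriangular (fun i j hij => hR i j hij)]
  exact Finset.prod_eq_zero (Finset.mem_univ i) hi

/-- Error analysis of the computed least squares solution: Householder QR is a perturbed orthogonal
transformation to an upper trapezoidal problem `(R, c)`, whose leading equations the computed
solution satisfies with a small residual; a breakdown exhibits a null vector of `R`. -/
theorem FloatArith.exists_leastSquares_spec {u : ℝ} (fl : FloatArith u) {p q n : ℕ} (hp : p ≤ n)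
    (hq : q ≤ n) (hn : 1 ≤ n) (h : n * (n * u) ≤ 1 / 1000) (M : Matrix (Fin p) (Fin q) ℝ)
    (b : Fin p → ℝ) :
    ∃ Q R c, IsPerturbedImage (200 * (n * (n * u))) Q M b R c ∧
      (∀ (i : Fin p) (l : Fin q), l.1 < i.1 → R i l = 0) ∧
      (∀ x, fl.leastSquares M b = some x → ∀ i : Fin p, i.1 < q →
        |c i - R.mulVec x i| ≤ 6 * (n * u) * (|c i| + ∑ j, |R i j| * |x j|)) ∧
      (fl.leastSquares M b = none → ∃ z, z ≠ 0 ∧ R.mulVec z = 0) := by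
  have hu := fl.unitRoundoff_nonneg
  have hn' : (1 : ℝ) ≤ n := by exact_mod_cast hn
  have h1 : n * u ≤ n * (n * u) := by nlinarith [mul_nonneg (zero_le_one.trans hn') hu]
  obtain ⟨⟨Q, hQ⟩, hz⟩ := fl.exists_isPerturbedImage_qrReduce hp hq hn h M b
  set S := fl.qrReduce M b with hS
  set R : Matrix (Fin q) (Fin q) ℝ := fun i j => top q (fun r => S.1 r j) i with hRd
  have hR : ∀ i j, j < i → R i j = 0 := by
    intro i j hij
    by_cases hip : i.1 < p
    · simpa [hRd, top, hip] using hz ⟨i, hip⟩ j hij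
    · simp [hRd, top, hip]
  have hRow : ∀ (i : Fin p) (hi : i.1 < q) j, R ⟨i, hi⟩ j = S.1 i j := by
    intro i hi j
    simp [hRd, top]
  refine ⟨Q, S.1, S.2, hQ, hz, fun x hx i hi => ?_, fun hnone => ?_⟩
  · rw [leastSquares] at hx
    simp only [← hS] at hx
    rw [← hRd] at hx
    split_ifs at hx with hd
    rw [Option.some.injEq] at hx
    have h2 := fl.abs_sub_mulVec_backSub_le hq hn (by linarith) R hR hd (top q S.2) ⟨i, hi⟩
    rw [hx] at h2
    have h3 : R.mulVec x ⟨i, hi⟩ = S.1.mulVec x i := by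
      simp [Matrix.mulVec, dotProduct, hRow]
    have h4 : top q S.2 ⟨i, hi⟩ = S.2 i := by simp [top]
    simp only [h3, h4, hRow] at h2
    exact h2
  · rw [leastSquares] at hnone
    simp only [← hS] at hnone
    rw [← hRd] at hnone
    split_ifs at hnone with hd
    push Not at hd
    obtain ⟨i, hi⟩ := hd
    obtain ⟨z, hz0, hz1⟩ := exists_mulVec_eq_zero_of_diag_eq_zero R hR hi
    refine ⟨z, hz0, funext fun i => ?_⟩
    by_cases hi : i.1 < q
    · have := congrFun hz1 ⟨i, hi⟩
      simpa [Matrix.mulVec, dotProduct, hRow] using this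
    · change ∑ j, S.1 i j * z j = 0
      refine Finset.sum_eq_zero fun j _ => ?_
      rw [hz i j (by omega), zero_mul]

/-! ### Residual and forward error of the computed least squares solution -/

/-- The weighted sum `∑ⱼ ‖M(:, j)‖₂ |yⱼ|`, which bounds the effect on `M y` of columnwise relative
perturbations of `M`. -/
noncomputable def colWeight {p q : ℕ} (M : Matrix (Fin p) (Fin q) ℝ) (y : Fin q → ℝ) : ℝ :=
  ∑ j, norm2 (fun i => M i j) * |y j|

theorem colWeight_nonneg {p q : ℕ} (M : Matrix (Fin p) (Fin q) ℝ) (y : Fin q → ℝ) :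
    0 ≤ colWeight M y :=
  Finset.sum_nonneg fun _ _ => mul_nonneg (norm2_nonneg _) (abs_nonneg _)

theorem colWeight_le_add {p q : ℕ} (M : Matrix (Fin p) (Fin q) ℝ) (x y : Fin q → ℝ) :
    colWeight M x ≤ colWeight M y + colWeight M (x - y) := by
  unfold colWeight
  rw [← Finset.sum_add_distrib]
  refine Finset.sum_le_sum fun j _ => ?_
  rw [← mul_add]
  refine mul_le_mul_of_nonneg_left ?_ (norm2_nonneg _)
  calc |x j| = |y j + (x - y) j| := by simp
    _ ≤ _ := abs_add_le _ _

theorem mulVec_eq_sum_smul_col {p q : ℕ} (M : Matrix (Fin p) (Fin q) ℝ) (y : Fin q → ℝ) :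
    M.mulVec y = ∑ j, y j • fun i => M i j := by
  funext i
  simp [Matrix.mulVec, dotProduct, mul_comm]

theorem norm2_mulVec_le_colWeight {p q : ℕ} (M : Matrix (Fin p) (Fin q) ℝ) (y : Fin q → ℝ) :
    norm2 (M.mulVec y) ≤ colWeight M y := by
  rw [mulVec_eq_sum_smul_col]
  refine (norm2_sum_le _ _).trans_eq (Finset.sum_congr rfl fun j _ => ?_)
  rw [norm2_smul, mul_comm]

/-- The entries of `y` in the rows before `q`, padded by zeros. -/
def headPart {p : ℕ} (q : ℕ) (y : Fin p → ℝ) : Fin p → ℝ := fun i => if i.1 < q then y i else 0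

theorem norm2_headPart_le {p : ℕ} (q : ℕ) (y : Fin p → ℝ) : norm2 (headPart q y) ≤ norm2 y := by
  refine norm2_le_norm2 fun i => ?_
  by_cases h : i.1 < q <;> simp [headPart, h]

theorem norm2_sub_headPart_le {p : ℕ} (q : ℕ) (y : Fin p → ℝ) :
    norm2 (y - headPart q y) ≤ norm2 y := by
  refine norm2_le_norm2 fun i => ?_
  by_cases h : i.1 < q <;> simp [headPart, h]

theorem headPart_eq_self {p q : ℕ} (hpq : p ≤ q) (y : Fin p → ℝ) : headPart q y = y := by
  funext i
  have : i.1 < q := i.2.trans_le hpq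
  simp [headPart, this]

theorem dotProduct_headPart {p q : ℕ} (y z : Fin p → ℝ) :
    headPart q y ⬝ᵥ z = headPart q y ⬝ᵥ headPart q z := by
  refine Finset.sum_congr rfl fun i _ => ?_
  by_cases h : i.1 < q <;> simp [headPart, h]

theorem headPart_mulVec_eq_self {p q : ℕ} {R : Matrix (Fin p) (Fin q) ℝ}
    (hR : ∀ (i : Fin p) (l : Fin q), l.1 < i.1 → R i l = 0) (y : Fin q → ℝ) :
    headPart q (R.mulVec y) = R.mulVec y := by
  funext i
  by_cases h : i.1 < q
  · simp [headPart, h]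
  · rw [headPart, if_neg h]
    change 0 = ∑ j, R i j * y j
    exact (Finset.sum_eq_zero fun j _ => by rw [hR i j (by omega), zero_mul]).symm

namespace IsPerturbedImage

variable {p q : ℕ} {η : ℝ} {Q : (Fin p → ℝ) →ₗ[ℝ] (Fin p → ℝ)} {M R : Matrix (Fin p) (Fin q) ℝ}
  {b c : Fin p → ℝ}

theorem norm2_mulVec_sub_le (h : IsPerturbedImage η Q M b R c) (y : Fin q → ℝ) :
    norm2 (R.mulVec y - Q (M.mulVec y)) ≤ η * colWeight M y := by
  rw [mulVec_eq_sum_smul_col, mulVec_eq_sum_smul_col, map_sum, ← Finset.sum_sub_distrib]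
  refine (norm2_sum_le _ _).trans ?_
  rw [colWeight, Finset.mul_sum]
  refine Finset.sum_le_sum fun j _ => ?_
  rw [map_smul, ← smul_sub, norm2_smul, mul_comm, ← mul_assoc]
  exact mul_le_mul_of_nonneg_right (h.col j) (abs_nonneg _)

theorem norm2_residual_sub_le (h : IsPerturbedImage η Q M b R c) (y : Fin q → ℝ) :
    norm2 ((c - R.mulVec y) - Q (b - M.mulVec y)) ≤ η * (norm2 b + colWeight M y) := by
  calc norm2 ((c - R.mulVec y) - Q (b - M.mulVec y))
      = norm2 ((c - Q b) - (R.mulVec y - Q (M.mulVec y))) := by rw [map_sub]; abel_nf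
    _ ≤ norm2 (c - Q b) + norm2 (R.mulVec y - Q (M.mulVec y)) := norm2_sub_le _ _
    _ ≤ η * norm2 b + η * colWeight M y := add_le_add h.rhs (h.norm2_mulVec_sub_le y)
    _ = _ := by ring

theorem norm2_residual_le (h : IsPerturbedImage η Q M b R c) (y : Fin q → ℝ) :
    norm2 (b - M.mulVec y) ≤ norm2 (c - R.mulVec y) + η * (norm2 b + colWeight M y) := by
  rw [← h.norm2_map]
  calc norm2 (Q (b - M.mulVec y))
      = norm2 ((c - R.mulVec y) - ((c - R.mulVec y) - Q (b - M.mulVec y))) := by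
        rw [sub_sub_cancel]
    _ ≤ _ := (norm2_sub_le _ _).trans (add_le_add le_rfl (h.norm2_residual_sub_le y))

theorem norm2_transformed_residual_le (h : IsPerturbedImage η Q M b R c) (y : Fin q → ℝ) :
    norm2 (c - R.mulVec y) ≤ norm2 (b - M.mulVec y) + η * (norm2 b + colWeight M y) := by
  rw [← h.norm2_map (b - M.mulVec y)]
  calc norm2 (c - R.mulVec y)
      = norm2 (Q (b - M.mulVec y) + ((c - R.mulVec y) - Q (b - M.mulVec y))) := by
        rw [add_sub_cancel]
    _ ≤ _ := (norm2_add_le _ _).trans (add_le_add le_rfl (h.norm2_residual_sub_le y))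

theorem norm2_rhs_le (h : IsPerturbedImage η Q M b R c) : norm2 c ≤ (1 + η) * norm2 b := by
  calc norm2 c = norm2 (Q b + (c - Q b)) := by rw [add_sub_cancel]
    _ ≤ norm2 (Q b) + norm2 (c - Q b) := norm2_add_le _ _
    _ ≤ _ := by rw [h.norm2_map]; linarith [h.rhs]

theorem norm2_col_le (h : IsPerturbedImage η Q M b R c) (l : Fin q) :
    norm2 (fun i => R i l) ≤ (1 + η) * norm2 (fun i => M i l) := by
  calc norm2 (fun i => R i l)
      = norm2 (Q (fun i => M i l) + ((fun i => R i l) - Q (fun i => M i l))) := by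
        rw [add_sub_cancel]
    _ ≤ norm2 (Q fun i => M i l) + norm2 ((fun i => R i l) - Q (fun i => M i l)) :=
        norm2_add_le _ _
    _ ≤ _ := by rw [h.norm2_map]; linarith [h.col l]

/-- A small residual in the leading equations of the transformed problem, normwise. -/
theorem norm2_headPart_le_of_abs_le (h : IsPerturbedImage η Q M b R c) {x : Fin q → ℝ} {δ : ℝ}
    (hδ : 0 ≤ δ)
    (hx : ∀ i : Fin p, i.1 < q →
      |c i - R.mulVec x i| ≤ δ * (|c i| + ∑ j, |R i j| * |x j|)) :
    norm2 (headPart q (c - R.mulVec x)) ≤ δ * ((1 + η) * (norm2 b + colWeight M x)) := by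
  have h1 : norm2 (headPart q (c - R.mulVec x)) ≤
      norm2 (δ • (absVec c + ∑ j, |x j| • absVec fun i => R i j)) := by
    refine norm2_le_norm2 fun i => ?_
    have h2 : (absVec c + ∑ j, |x j| • absVec fun i => R i j) i =
        |c i| + ∑ j, |R i j| * |x j| := by
      simp [absVec, mul_comm]
    rw [Pi.smul_apply, smul_eq_mul, h2]
    refine le_trans ?_ (le_abs_self _)
    by_cases hi : i.1 < q
    · simpa [headPart, hi] using hx i hi
    · simp only [headPart, hi, if_false, abs_zero]
      exact mul_nonneg hδ (add_nonneg (abs_nonneg _) (Finset.sum_nonneg fun j _ => by positivity))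
  refine h1.trans ?_
  rw [norm2_smul, abs_of_nonneg hδ]
  refine mul_le_mul_of_nonneg_left ?_ hδ
  refine (norm2_add_le _ _).trans ?_
  rw [norm2_absVec, mul_add]
  refine add_le_add h.norm2_rhs_le ((norm2_sum_le _ _).trans ?_)
  rw [colWeight, Finset.mul_sum]
  refine Finset.sum_le_sum fun j _ => ?_
  rw [norm2_smul, norm2_absVec, abs_abs, mul_comm, ← mul_assoc]
  exact mul_le_mul_of_nonneg_right (h.norm2_col_le j) (abs_nonneg _)

/-- The trailing part of the transformed right-hand side does not involve the unknowns, so that it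
is bounded by the residual of any vector `x`. -/
theorem norm2_residual_le_add (h : IsPerturbedImage η Q M b R c)
    (hR : ∀ (i : Fin p) (l : Fin q), l.1 < i.1 → R i l = 0) (x y : Fin q → ℝ) :
    norm2 (b - M.mulVec y) ≤ norm2 (b - M.mulVec x) + norm2 (headPart q (c - R.mulVec y)) +
      η * (norm2 b + colWeight M x) + η * (norm2 b + colWeight M y) := by
  have h1 : ∀ z, (c - R.mulVec z) - headPart q (c - R.mulVec z) = c - headPart q c := by
    intro z
    have h2 : headPart q (c - R.mulVec z) = headPart q c - headPart q (R.mulVec z) := by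
      funext i
      by_cases hi : i.1 < q <;> simp [headPart, hi]
    rw [h2, headPart_mulVec_eq_self hR]
    abel
  have h3 : norm2 (c - R.mulVec y) ≤
      norm2 (headPart q (c - R.mulVec y)) + norm2 (c - headPart q c) := by
    rw [← h1 y]
    refine le_trans (le_of_eq ?_) (norm2_add_le _ _)
    rw [add_sub_cancel]
  have h4 : norm2 (c - headPart q c) ≤ norm2 (c - R.mulVec x) := by
    rw [← h1 x]
    exact norm2_sub_headPart_le _ _
  linarith [h.norm2_residual_le y, h.norm2_transformed_residual_le x]

/-- First order perturbation bound for the solution `x` of a least squares problem with full rank: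
a vector `y` that solves the leading equations of the perturbed transformed problem up to a small
residual differs from `x` by `O(η)`. It rests on `‖M (x - y)‖² = ⟨M (x - y), b - M y⟩`, where the
right-hand side is moved to the transformed problem: there the residual of `y` is small in the
leading rows, and `R (x - y)` vanishes in the other ones. -/
theorem norm2_sub_le_of_orthogonal (h : IsPerturbedImage η Q M b R c) (hη : 0 ≤ η) (hη1 : η ≤ 1)
    (hR : ∀ (i : Fin p) (l : Fin q), l.1 < i.1 → R i l = 0) {x y : Fin q → ℝ}
    (hx : ∀ z, M.mulVec z ⬝ᵥ (b - M.mulVec x) = 0)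
    (hy : norm2 (headPart q (c - R.mulVec y)) ≤ η * (norm2 b + colWeight M y))
    (hb : norm2 b ≤ 1) {s L : ℝ} (hs : 0 < s) (hL : 0 ≤ L)
    (hMs : ∀ z, s * norm2 z ≤ norm2 (M.mulVec z)) (hML : ∀ z, colWeight M z ≤ L * norm2 z)
    (hηL : η * L ≤ s / 4) :
    norm2 (x - y) ≤ η * ((3 * (1 + 6 * L / s) + L / s * (5 + 6 * L / s)) / s) := by
  have hRM : ∀ z, norm2 (R.mulVec z) ≤ norm2 (M.mulVec z) + η * L * norm2 z := by
    intro z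
    calc norm2 (R.mulVec z) = norm2 (Q (M.mulVec z) + (R.mulVec z - Q (M.mulVec z))) := by
          rw [add_sub_cancel]
      _ ≤ norm2 (Q (M.mulVec z)) + norm2 (R.mulVec z - Q (M.mulVec z)) := norm2_add_le _ _
      _ ≤ norm2 (M.mulVec z) + η * (L * norm2 z) := by
          rw [h.norm2_map]
          exact add_le_add le_rfl ((h.norm2_mulVec_sub_le z).trans
            (mul_le_mul_of_nonneg_left (hML z) hη))
      _ = _ := by ring
  have hRM2 : ∀ z, norm2 (R.mulVec z) ≤ 2 * norm2 (M.mulVec z) := by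
    intro z
    have := hRM z
    have h2 := hMs z
    have h3 : η * L * norm2 z ≤ s / 4 * norm2 z :=
      mul_le_mul_of_nonneg_right hηL (norm2_nonneg z)
    have h4 := norm2_nonneg (M.mulVec z)
    linarith
  have hy0 := norm2_nonneg y
  have hc : norm2 c ≤ 2 := by
    have h1 := h.norm2_rhs_le
    have h2 := norm2_nonneg b
    nlinarith
  -- `‖y‖ ≤ 6 / s`, absorbing the terms with `η L ‖y‖` into `s ‖y‖`
  have hyN : norm2 b + colWeight M y ≤ 1 + L * norm2 y := add_le_add hb (hML y)
  have hRy : norm2 (R.mulVec y) ≤ 2 + η * (1 + L * norm2 y) := by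
    calc norm2 (R.mulVec y)
        = norm2 (headPart q c - headPart q (c - R.mulVec y)) := by
          congr 1
          rw [← headPart_mulVec_eq_self hR y]
          funext i
          by_cases hi : i.1 < q <;> simp [headPart, hi]
      _ ≤ norm2 (headPart q c) + norm2 (headPart q (c - R.mulVec y)) := norm2_sub_le _ _
      _ ≤ 2 + η * (1 + L * norm2 y) :=
          add_le_add ((norm2_headPart_le q c).trans hc)
            (hy.trans (mul_le_mul_of_nonneg_left hyN hη))
  have hMy : norm2 (M.mulVec y) ≤ norm2 (R.mulVec y) + η * L * norm2 y := by
    rw [← h.norm2_map]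
    calc norm2 (Q (M.mulVec y)) = norm2 (R.mulVec y - (R.mulVec y - Q (M.mulVec y))) := by
          rw [sub_sub_cancel]
      _ ≤ norm2 (R.mulVec y) + norm2 (R.mulVec y - Q (M.mulVec y)) := norm2_sub_le _ _
      _ ≤ norm2 (R.mulVec y) + η * (L * norm2 y) :=
          add_le_add le_rfl ((h.norm2_mulVec_sub_le y).trans
            (mul_le_mul_of_nonneg_left (hML y) hη))
      _ = _ := by ring
  have hηLy : η * L * norm2 y ≤ s / 4 * norm2 y := mul_le_mul_of_nonneg_right hηL hy0
  have hys : norm2 y ≤ 6 / s := by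
    rw [le_div_iff₀ hs]
    have := hMs y
    nlinarith
  have hLy : L * norm2 y ≤ 6 * L / s := by
    calc L * norm2 y ≤ L * (6 / s) := mul_le_mul_of_nonneg_left hys hL
      _ = _ := by ring
  set D := 1 + 6 * L / s with hD
  have hD0 : 0 ≤ D := by positivity
  have hyD : norm2 b + colWeight M y ≤ D := by linarith
  -- the residual of `y` in the transformed problem
  set w := c - R.mulVec y with hw
  have hwn : norm2 w ≤ 5 + 6 * L / s := by
    have h1 : norm2 w ≤ norm2 c + norm2 (R.mulVec y) := norm2_sub_le _ _
    have h2 : η * (1 + L * norm2 y) ≤ 1 + 6 * L / s := by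
      have : 0 ≤ L * norm2 y := mul_nonneg hL hy0
      nlinarith
    linarith
  set z := x - y with hz
  set m := norm2 (M.mulVec z) with hm
  have hm0 : 0 ≤ m := norm2_nonneg _
  have hzm : norm2 z ≤ m / s := by
    rw [le_div_iff₀ hs, mul_comm]
    exact hMs z
  have hkey : m ^ 2 = Q (M.mulVec z) ⬝ᵥ Q (b - M.mulVec y) := by
    rw [dotProduct_map_map Q h.norm2_map]
    have h1 : b - M.mulVec y = (b - M.mulVec x) + M.mulVec z := by
      rw [hz, Matrix.mulVec_sub]; abel
    rw [h1, dotProduct_add, hx z, zero_add, hm, norm2_sq_eq_dotProduct]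
  set E := w - Q (b - M.mulVec y) with hE
  set F := R.mulVec z - Q (M.mulVec z) with hF
  have hEn : norm2 E ≤ η * D :=
    (h.norm2_residual_sub_le y).trans (mul_le_mul_of_nonneg_left hyD hη)
  have hFn : norm2 F ≤ η * (L * (m / s)) :=
    (h.norm2_mulVec_sub_le z).trans (mul_le_mul_of_nonneg_left
      ((hML z).trans (mul_le_mul_of_nonneg_left hzm hL)) hη)
  have hsplit : m ^ 2 =
      R.mulVec z ⬝ᵥ headPart q w + (-F) ⬝ᵥ w + Q (M.mulVec z) ⬝ᵥ (-E) := by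
    have h1 : R.mulVec z ⬝ᵥ headPart q w = R.mulVec z ⬝ᵥ w := by
      rw [← headPart_mulVec_eq_self hR z, ← dotProduct_headPart]
    rw [hkey, h1, hE, hF]
    simp only [neg_sub, sub_dotProduct, dotProduct_sub]
    ring
  have h1 : R.mulVec z ⬝ᵥ headPart q w ≤ 2 * m * (η * D) :=
    (dotProduct_le_norm2_mul _ _).trans (mul_le_mul (hRM2 z)
      (hy.trans (mul_le_mul_of_nonneg_left hyD hη)) (norm2_nonneg _) (by positivity))
  have h2 : (-F) ⬝ᵥ w ≤ η * (L * (m / s)) * (5 + 6 * L / s) := by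
    refine (dotProduct_le_norm2_mul _ _).trans ?_
    rw [norm2_neg]
    exact mul_le_mul hFn hwn (norm2_nonneg _) (by positivity)
  have h3 : Q (M.mulVec z) ⬝ᵥ (-E) ≤ m * (η * D) := by
    refine (dotProduct_le_norm2_mul _ _).trans ?_
    rw [norm2_neg, h.norm2_map]
    exact mul_le_mul_of_nonneg_left hEn hm0
  have h4 : m * m ≤ (η * (3 * D + L / s * (5 + 6 * L / s))) * m := by
    calc m * m = m ^ 2 := by ring
      _ ≤ 2 * m * (η * D) + η * (L * (m / s)) * (5 + 6 * L / s) + m * (η * D) := by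
        rw [hsplit]; linarith
      _ = _ := by ring
  have h5 : m ≤ η * (3 * D + L / s * (5 + 6 * L / s)) := by
    rcases hm0.eq_or_lt with h0 | h0
    · rw [← h0]; positivity
    · exact le_of_mul_le_mul_right h4 h0
  calc norm2 z ≤ m / s := hzm
    _ ≤ (η * (3 * D + L / s * (5 + 6 * L / s))) / s := by gcongr
    _ = _ := by ring

end IsPerturbedImage

/-! ### From the reduced problem to the whole matrix -/

theorem sum_comp_le_sum {m n : ℕ} (e : Fin m ↪o Fin n) {f : Fin n → ℝ} (hf : ∀ i, 0 ≤ f i) :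
    ∑ i, f (e i) ≤ ∑ i, f i := by
  have h1 : ∑ i, f (e i) = ∑ i ∈ Finset.univ.map e.toEmbedding, f i := by
    rw [Finset.sum_map]; rfl
  rw [h1]
  exact Finset.sum_le_sum_of_subset_of_nonneg (Finset.subset_univ _) fun i _ _ => hf i

theorem norm2_comp_le {m n : ℕ} (e : Fin m ↪o Fin n) (v : Fin n → ℝ) :
    norm2 (fun i => v (e i)) ≤ norm2 v := by
  rw [norm2_eq_sqrt, norm2_eq_sqrt]
  exact Real.sqrt_le_sqrt (sum_comp_le_sum e fun i => sq_nonneg (v i))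

section Pattern

variable {n : ℕ} (B : Matrix (Fin n) (Fin n) ℝ) (J : Finset (Fin n))

/-- The matrix `B(I, J)` of the reduced problem, with `I` the shadow of `J`. -/
noncomputable def reducedMatrix : Matrix (Fin (shadow B J).card) (Fin J.card) ℝ :=
  B.submatrix ((shadow B J).orderEmbOfFin rfl) (J.orderEmbOfFin rfl)

/-- The right-hand side `e_k(I)` of the reduced problem, with `I` the shadow of `J`. -/
noncomputable def reducedRhs (k : Fin n) : Fin (shadow B J).card → ℝ :=
  fun i => unitVec k ((shadow B J).orderEmbOfFin rfl i)

/-- The vector with entries `z` in the positions `J` and zeros elsewhere. -/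
noncomputable def extendBy (z : Fin J.card → ℝ) : Fin n → ℝ :=
  Function.extend (J.orderEmbOfFin rfl) z 0

theorem spaiColumn_eq {u : ℝ} (fl : FloatArith u) (k : Fin n) :
    spaiColumn fl B k J =
      (fl.leastSquares (reducedMatrix B J) (reducedRhs B J k)).map (extendBy J) := rfl

theorem extendBy_apply (z : Fin J.card → ℝ) (j : Fin J.card) :
    extendBy J z (J.orderEmbOfFin rfl j) = z j :=
  (J.orderEmbOfFin rfl).injective.extend_apply z 0 j

theorem extendBy_of_notMem (z : Fin J.card → ℝ) {j : Fin n} (hj : j ∉ J) : extendBy J z j = 0 := by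
  refine Function.extend_apply' _ _ _ ?_
  rintro ⟨i, rfl⟩
  exact hj (J.orderEmbOfFin_mem rfl i)

theorem exists_orderEmbOfFin_eq {j : Fin n} (hj : j ∈ J) : ∃ i, J.orderEmbOfFin rfl i = j := by
  have : j ∈ Set.range (J.orderEmbOfFin rfl) := by
    rw [Finset.range_orderEmbOfFin]; exact hj
  exact this

theorem extendBy_restrict {m : Fin n → ℝ} (hm : ∀ j, j ∉ J → m j = 0) :
    extendBy J (fun i => m (J.orderEmbOfFin rfl i)) = m := by
  funext j
  by_cases hj : j ∈ J
  · obtain ⟨i, rfl⟩ := exists_orderEmbOfFin_eq J hj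
    rw [extendBy_apply]
  · rw [extendBy_of_notMem J _ hj, hm j hj]

/-- Sums over all positions reduce to sums over the pattern. -/
theorem sum_mul_extendBy (f : Fin n → ℝ) (z : Fin J.card → ℝ) :
    ∑ j, f j * extendBy J z j = ∑ j, f (J.orderEmbOfFin rfl j) * z j := by
  symm
  refine Fintype.sum_of_injective (J.orderEmbOfFin rfl) (J.orderEmbOfFin rfl).injective _ _
    (fun j hj => ?_) fun j => by rw [extendBy_apply]
  have : j ∉ J := fun h => hj (exists_orderEmbOfFin_eq J h)
  rw [extendBy_of_notMem J z this, mul_zero]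

theorem absVec_extendBy (z : Fin J.card → ℝ) : absVec (extendBy J z) = extendBy J (absVec z) := by
  funext j
  by_cases hj : j ∈ J
  · obtain ⟨i, rfl⟩ := exists_orderEmbOfFin_eq J hj
    simp [absVec, extendBy_apply]
  · simp [absVec, extendBy_of_notMem J _ hj]

theorem mulVec_extendBy_apply (z : Fin J.card → ℝ) (i : Fin (shadow B J).card) :
    B.mulVec (extendBy J z) ((shadow B J).orderEmbOfFin rfl i) =
      (reducedMatrix B J).mulVec z i :=
  sum_mul_extendBy J _ z

theorem mulVec_extendBy_of_notMem (z : Fin J.card → ℝ) {i : Fin n} (hi : i ∉ shadow B J) :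
    B.mulVec (extendBy J z) i = 0 := by
  have h1 : ∑ j ∈ J, |B i j| = 0 := by
    by_contra h
    exact hi (by simp [shadow, h])
  rw [Finset.sum_eq_zero_iff_of_nonneg fun j _ => abs_nonneg _] at h1
  change ∑ j, B i j * extendBy J z j = 0
  refine Finset.sum_eq_zero fun j _ => ?_
  by_cases hj : j ∈ J
  · rw [abs_eq_zero.mp (h1 j hj), zero_mul]
  · rw [extendBy_of_notMem J z hj, mul_zero]

/-- Pythagoras for the rows inside and outside the shadow. -/
theorem norm2_sub_mulVec_extendBy_sq (v : Fin n → ℝ) (z : Fin J.card → ℝ) :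
    norm2 (v - B.mulVec (extendBy J z)) ^ 2 =
      norm2 ((fun i => v ((shadow B J).orderEmbOfFin rfl i)) - (reducedMatrix B J).mulVec z) ^ 2 +
        ∑ i ∈ (shadow B J)ᶜ, v i ^ 2 := by
  rw [norm2_sq, norm2_sq, ← Finset.sum_add_sum_compl (shadow B J)]
  congr 1
  · symm
    refine Finset.sum_bij (fun i _ => (shadow B J).orderEmbOfFin rfl i)
      (fun i _ => Finset.orderEmbOfFin_mem _ _ i)
      (fun i _ j _ h => ((shadow B J).orderEmbOfFin rfl).injective h)
      (fun i hi => ?_) (fun i _ => ?_)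
    · obtain ⟨j, hj⟩ := exists_orderEmbOfFin_eq _ hi
      exact ⟨j, Finset.mem_univ _, hj⟩
    · rw [Pi.sub_apply, Pi.sub_apply, mulVec_extendBy_apply]
  · refine Finset.sum_congr rfl fun i hi => ?_
    rw [Pi.sub_apply, mulVec_extendBy_of_notMem B J z (Finset.mem_compl.mp hi), sub_zero]

theorem norm2_mulVec_extendBy (z : Fin J.card → ℝ) :
    norm2 (B.mulVec (extendBy J z)) = norm2 ((reducedMatrix B J).mulVec z) := by
  have h := norm2_sub_mulVec_extendBy_sq B J 0 z
  have h0 : (fun i => (0 : Fin n → ℝ) ((shadow B J).orderEmbOfFin rfl i)) = 0 := rfl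
  rw [h0, zero_sub, zero_sub, norm2_neg, norm2_neg] at h
  simpa [sq_eq_sq₀, norm2_nonneg] using h

theorem norm2_extendBy (z : Fin J.card → ℝ) : norm2 (extendBy J z) = norm2 z := by
  rw [← sq_eq_sq₀ (norm2_nonneg _) (norm2_nonneg _), norm2_sq, norm2_sq]
  simp only [sq]
  rw [sum_mul_extendBy]
  simp only [extendBy_apply]

theorem norm2_reducedRhs_le (k : Fin n) : norm2 (reducedRhs B J k) ≤ norm2 (unitVec k) :=
  norm2_comp_le _ _

theorem colWeight_reducedMatrix_le (z : Fin J.card → ℝ) :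
    colWeight (reducedMatrix B J) z ≤ colWeight B (extendBy J z) := by
  have h : colWeight B (extendBy J z) =
      ∑ j, norm2 (fun i => B i (J.orderEmbOfFin rfl j)) * |z j| := by
    have := sum_mul_extendBy J (fun j => norm2 fun i => B i j) (absVec z)
    rw [← absVec_extendBy] at this
    exact this
  rw [h]
  exact Finset.sum_le_sum fun j _ => mul_le_mul_of_nonneg_right
    (norm2_comp_le ((shadow B J).orderEmbOfFin rfl) fun i => B i (J.orderEmbOfFin rfl j))
    (abs_nonneg _)

end Pattern

section DataSize

variable {n : ℕ} (B : Matrix (Fin n) (Fin n) ℝ)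

theorem absMat_mulVec_absVec_nonneg (w : Fin n → ℝ) (i : Fin n) :
    0 ≤ (absMat B).mulVec (absVec w) i := by
  change 0 ≤ ∑ j, |B i j| * |w j|
  exact Finset.sum_nonneg fun _ _ => mul_nonneg (abs_nonneg _) (abs_nonneg _)

theorem colWeight_le_sum (w : Fin n → ℝ) :
    colWeight B w ≤ ∑ i, (absMat B).mulVec (absVec w) i := by
  calc colWeight B w ≤ ∑ j, (∑ i, |B i j|) * |w j| :=
        Finset.sum_le_sum fun j _ =>
          mul_le_mul_of_nonneg_right (norm2_le_sum_abs _) (abs_nonneg _)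
    _ = ∑ i, ∑ j, |B i j| * |w j| := by
        simp only [Finset.sum_mul]
        exact Finset.sum_comm

theorem colWeight_le_card_mul (w : Fin n → ℝ) :
    colWeight B w ≤ n * norm2 ((absMat B).mulVec (absVec w)) := by
  refine (colWeight_le_sum B w).trans (le_trans ?_ (sum_abs_le_card_mul_norm2 _))
  exact Finset.sum_le_sum fun i _ => le_abs_self _

theorem norm2_add_colWeight_le (k : Fin n) (w : Fin n → ℝ) :
    norm2 (unitVec k) + colWeight B w ≤ n * dataSize B k w := by
  refine le_trans (add_le_add (norm2_le_sum_abs _) (colWeight_le_sum B w)) ?_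
  rw [← Finset.sum_add_distrib]
  refine le_trans ?_ (sum_abs_le_card_mul_norm2 _)
  exact Finset.sum_le_sum fun i _ => le_abs_self _

theorem norm2_unitVec (k : Fin n) : norm2 (unitVec k) = 1 := by
  rw [norm2_eq_sqrt]
  simp [unitVec, Pi.single_apply]

theorem dataSize_nonneg (k : Fin n) (w : Fin n → ℝ) : 0 ≤ dataSize B k w := norm2_nonneg _

theorem colWeight_le_mul_norm2 {p q : ℕ} (M : Matrix (Fin p) (Fin q) ℝ) (w : Fin q → ℝ) :
    colWeight M w ≤ (∑ j, norm2 fun i => M i j) * norm2 w := by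
  rw [Finset.sum_mul]
  exact Finset.sum_le_sum fun j _ =>
    mul_le_mul_of_nonneg_left (abs_le_norm2 w j) (norm2_nonneg _)

end DataSize

/-- The computed residual is close to the exact residual of the computed column. -/
theorem norm2_spaiResidual_le {u : ℝ} (fl : FloatArith u) {n : ℕ} (hn : 1 ≤ n)
    (h : n * u ≤ 1 / 1000) (B : Matrix (Fin n) (Fin n) ℝ) (k : Fin n) (m : Fin n → ℝ) :
    norm2 (spaiResidual fl B k m) ≤
      norm2 (unitVec k - B.mulVec m) + 6 * (n * u) * dataSize B k m := by
  have hu := fl.unitRoundoff_nonneg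
  have hun := fl.unitRoundoff_le hn
  obtain ⟨he1, he2, he3⟩ := mul_le_of_small hu hun h
  set e := n * u with he
  have he0 : 0 ≤ e := hu.trans hun
  have h1 : norm2 (spaiResidual fl B k m - (unitVec k - B.mulVec m)) ≤
      norm2 ((6 * e) • (absVec (unitVec k) + (absMat B).mulVec (absVec m))) := by
    refine norm2_le_norm2 fun i => le_trans ?_ (le_abs_self _)
    have h2 := fl.abs_dot_sub_le le_rfl hn (by linarith) (fun _ => True) (B i) m
    simp only [decide_true, List.filter_true, if_true] at h2
    rw [← he] at h2
    set D := fl.dot (List.finRange n) (B i) m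
    have hT : (∑ j, |B i j * m j|) = (absMat B).mulVec (absVec m) i :=
      Finset.sum_congr rfl fun j _ => abs_mul _ _
    have hs : (∑ j, B i j * m j) = B.mulVec m i := rfl
    rw [hT, hs] at h2
    have hT0 := absMat_mulVec_absVec_nonneg B m i
    set T := (absMat B).mulVec (absVec m) i
    set W := |unitVec k i| + T with hW
    have hW0 : 0 ≤ W := by positivity
    have h3 : |(unitVec k i - D) - (unitVec k i - B.mulVec m i)| ≤ 4 * e * W := by
      have : (unitVec k i - D) - (unitVec k i - B.mulVec m i) = -(D - B.mulVec m i) := by ring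
      rw [this, abs_neg]
      refine h2.trans (mul_le_mul_of_nonneg_left ?_ (by positivity))
      linarith [abs_nonneg ((unitVec k : Fin n → ℝ) i)]
    have h4 : |unitVec k i - B.mulVec m i| ≤ W := by
      refine (abs_sub _ _).trans (add_le_add le_rfl ?_)
      rw [← hs]
      exact (Finset.abs_sum_le_sum_abs _ _).trans_eq hT
    have h5 := abs_sub_le_of_rounded hu h3 h4 (fl.fsub_err (unitVec k i) D)
    change |fl.fsub (unitVec k i) D - (unitVec k i - B.mulVec m i)| ≤ 6 * e * W
    exact h5.trans (mul_le_mul_of_nonneg_right (by linarith) hW0)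
  rw [norm2_smul, abs_of_nonneg (by positivity)] at h1
  calc norm2 (spaiResidual fl B k m)
      = norm2 ((unitVec k - B.mulVec m) +
          (spaiResidual fl B k m - (unitVec k - B.mulVec m))) := by rw [add_sub_cancel]
    _ ≤ _ := (norm2_add_le _ _).trans (add_le_add le_rfl h1)

/-! ### The computed column -/

section Column

variable {u : ℝ} (fl : FloatArith u) {n : ℕ} (B : Matrix (Fin n) (Fin n) ℝ) (J : Finset (Fin n))
  (k : Fin n)

/-- If `κ` bounds the growth from `B w` to `|B| |w|` and `n³ u κ` is small, then Householder QR does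
not break down for any pattern. -/
theorem exists_spaiColumn_eq_some {κ : ℝ} (hn : 1 ≤ n) (h : n * (n * u) ≤ 1 / 1000)
    (hκ : ∀ w, norm2 ((absMat B).mulVec (absVec w)) ≤ κ * norm2 (B.mulVec w))
    (hB : ∀ w, B.mulVec w = 0 → w = 0)
    (hsmall : 200 * (n * (n * (n * u))) * κ < 1) :
    ∃ x, fl.leastSquares (reducedMatrix B J) (reducedRhs B J k) = some x ∧
      spaiColumn fl B k J = some (extendBy J x) := by
  have hu := fl.unitRoundoff_nonneg
  obtain ⟨Q, R, c, hQ, -, -, hnone⟩ := fl.exists_leastSquares_spec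
    (Finset.card_le_univ (shadow B J) |>.trans_eq (Fintype.card_fin n))
    (Finset.card_le_univ J |>.trans_eq (Fintype.card_fin n)) hn h
    (reducedMatrix B J) (reducedRhs B J k)
  rw [spaiColumn_eq]
  cases hx : fl.leastSquares (reducedMatrix B J) (reducedRhs B J k) with
  | some x => exact ⟨x, rfl, rfl⟩
  | none =>
    exfalso
    obtain ⟨z, hz0, hz⟩ := hnone hx
    have h1 := hQ.norm2_mulVec_sub_le z
    rw [hz, zero_sub, norm2_neg, hQ.norm2_map, ← norm2_mulVec_extendBy] at h1
    set w := extendBy J z with hw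
    have h2 : colWeight (reducedMatrix B J) z ≤ n * (κ * norm2 (B.mulVec w)) :=
      (colWeight_reducedMatrix_le B J z).trans ((colWeight_le_card_mul B w).trans
        (mul_le_mul_of_nonneg_left (hκ w) (Nat.cast_nonneg n)))
    have h3 := h1.trans (mul_le_mul_of_nonneg_left h2 (by positivity))
    have h4 : norm2 (B.mulVec w) = 0 := by
      by_contra hne
      have hpos := (norm2_nonneg (B.mulVec w)).lt_of_ne' hne
      have h5 : 200 * (n * (n * u)) * (n * (κ * norm2 (B.mulVec w))) =
          200 * (n * (n * (n * u))) * κ * norm2 (B.mulVec w) := by ring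
      rw [h5] at h3
      nlinarith
    have h5 := hB w (eq_zero_of_norm2_eq_zero h4)
    refine hz0 (eq_zero_of_norm2_eq_zero ?_)
    rw [← norm2_extendBy J z, ← hw, h5, norm2_zero]

variable {B J k}

theorem norm2_add_colWeight_reduced_le (z : Fin J.card → ℝ) :
    norm2 (reducedRhs B J k) + colWeight (reducedMatrix B J) z ≤ n * dataSize B k (extendBy J z) :=
  (add_le_add (norm2_reducedRhs_le B J k) (colWeight_reducedMatrix_le B J z)).trans
    (norm2_add_colWeight_le B k _)

/-- For the full pattern the triangular system has no trailing part, and the computed column has a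
small exact residual. -/
theorem norm2_sub_mulVec_le_of_univ (hn : 1 ≤ n) (h : n * (n * u) ≤ 1 / 1000)
    (hB : shadow B Finset.univ = Finset.univ) {m : Fin n → ℝ}
    (hm : spaiColumn fl B k Finset.univ = some m) :
    norm2 (unitVec k - B.mulVec m) ≤ 208 * (n * (n * (n * u))) * dataSize B k m := by
  have hu := fl.unitRoundoff_nonneg
  have hn' : (1 : ℝ) ≤ n := by exact_mod_cast hn
  have he : 0 ≤ n * u := by positivity
  have hne : n * u ≤ n * (n * u) := by nlinarith
  rw [spaiColumn_eq, Option.map_eq_some_iff] at hm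
  obtain ⟨x, hx, rfl⟩ := hm
  have hI : (shadow B Finset.univ).card ≤ n :=
    (Finset.card_le_univ _).trans_eq (Fintype.card_fin n)
  have hJ : (Finset.univ : Finset (Fin n)).card = n := Finset.card_fin n
  obtain ⟨Q, R, c, hQ, -, hres, -⟩ := fl.exists_leastSquares_spec hI hJ.le hn h
    (reducedMatrix B Finset.univ) (reducedRhs B Finset.univ k)
  have h1 := hQ.norm2_headPart_le_of_abs_le (by positivity) (hres x hx)
  rw [headPart_eq_self (hI.trans_eq hJ.symm)] at h1
  have h2 := hQ.norm2_residual_le x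
  have h3 := norm2_sub_mulVec_extendBy_sq B Finset.univ (unitVec k) x
  have h4 : ∑ i ∈ (shadow B Finset.univ)ᶜ, (unitVec k : Fin n → ℝ) i ^ 2 = 0 := by
    rw [Finset.compl_eq_empty_iff _ |>.mpr hB, Finset.sum_empty]
  rw [h4, add_zero, sq_eq_sq₀ (norm2_nonneg _) (norm2_nonneg _)] at h3
  rw [h3]
  have h5 := norm2_add_colWeight_reduced_le (B := B) (J := Finset.univ) (k := k) x
  change norm2 (reducedRhs B Finset.univ k - _) ≤ _
  set D := norm2 (reducedRhs B Finset.univ k) + colWeight (reducedMatrix B Finset.univ) x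
  have hD : 0 ≤ D := add_nonneg (norm2_nonneg _) (colWeight_nonneg _ _)
  set g := n * (n * u) with hg
  have hg0 : 0 ≤ g := by positivity
  calc norm2 (reducedRhs B Finset.univ k - (reducedMatrix B Finset.univ).mulVec x)
      ≤ 6 * (n * u) * ((1 + 200 * g) * D) + 200 * g * D := by linarith
    _ ≤ 208 * g * D := by
      have h6 : 6 * (n * u) * (1 + 200 * g) ≤ 8 * g := by nlinarith
      nlinarith [mul_le_mul_of_nonneg_right h6 hD]
    _ ≤ 208 * g * (n * dataSize B k (extendBy Finset.univ x)) := by gcongr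
    _ = _ := by rw [hg]; ring

/-- The least squares residual is orthogonal to the range of the matrix. -/
theorem IsExactColumn.orthogonal {m : Fin n → ℝ} (hm : IsExactColumn B k J m) {w : Fin n → ℝ}
    (hw : ∀ j, j ∉ J → w j = 0) : B.mulVec w ⬝ᵥ (unitVec k - B.mulVec m) = 0 := by
  set r := unitVec k - B.mulVec m with hr
  set v := B.mulVec w with hv
  have h1 : ∀ t : ℝ, 0 ≤ t ^ 2 * (v ⬝ᵥ v) - 2 * t * (v ⬝ᵥ r) := by
    intro t
    have h2 := hm.2 (m + t • w) fun j hj => by simp [hm.1 j hj, hw j hj]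
    have h3 : unitVec k - B.mulVec (m + t • w) = r - t • v := by
      rw [Matrix.mulVec_add, Matrix.mulVec_smul, hr, hv]; abel
    rw [h3, ← hr, ← sq_le_sq₀ (norm2_nonneg _) (norm2_nonneg _), norm2_sq_eq_dotProduct,
      norm2_sq_eq_dotProduct] at h2
    simp only [sub_dotProduct, dotProduct_sub, smul_dotProduct, dotProduct_smul, smul_eq_mul,
      dotProduct_comm r v] at h2
    linarith
  have h2 : 0 ≤ v ⬝ᵥ v := by rw [← norm2_sq_eq_dotProduct]; positivity
  -- the minimum over `t` of the quadratic is negative unless the linear term vanishes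
  have h3 := h1 ((v ⬝ᵥ r) / (v ⬝ᵥ v + 1))
  have h4 : 0 < v ⬝ᵥ v + 1 := by linarith
  have h5 : ((v ⬝ᵥ r) / (v ⬝ᵥ v + 1)) ^ 2 * (v ⬝ᵥ v) - 2 * ((v ⬝ᵥ r) / (v ⬝ᵥ v + 1)) * (v ⬝ᵥ r) =
      -((v ⬝ᵥ r) ^ 2 * (v ⬝ᵥ v + 2)) / (v ⬝ᵥ v + 1) ^ 2 := by
    field_simp
    ring
  rw [h5, le_div_iff₀ (by positivity), zero_mul] at h3
  have h6 : (v ⬝ᵥ r) ^ 2 = 0 := by nlinarith [sq_nonneg (v ⬝ᵥ r)]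
  exact pow_eq_zero_iff two_ne_zero |>.mp h6

/-- Minkowski's inequality for appending to two vectors of norms `r` and `r'` the same further
entries, whose squares sum to `δ`. -/
theorem le_add_of_sq_eq_add {a a' r r' t δ : ℝ} (hr' : 0 ≤ r')
    (ht : 0 ≤ t) (h : r' ≤ r + t) (h1 : a' ^ 2 = r' ^ 2 + δ) (hδ : 0 ≤ δ) (ha : 0 ≤ a)
    (h2 : a ^ 2 = r ^ 2 + δ) : a' ≤ a + t := by
  have hra : r ≤ a := by
    apply le_of_sq_le_sq _ ha
    linarith
  apply le_of_sq_le_sq _ (by positivity)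
  nlinarith [mul_self_le_mul_self hr' h]

/-- Residual bound for an arbitrary pattern. The unknown exact solution enters only through
`x - y = O(u)`, so that its contribution is of second order. -/
theorem norm2_sub_mulVec_le (hn : 1 ≤ n) (h : n * (n * u) ≤ 1 / 1000) {s L : ℝ} (hs : 0 < s)
    (hL : ∀ w, colWeight B w ≤ L * norm2 w) (hL0 : 0 ≤ L)
    (hBs : ∀ w, s * norm2 w ≤ norm2 (B.mulVec w)) (hsmall : 200 * (n * (n * u)) * L ≤ s / 4)
    {y : Fin J.card → ℝ}
    (hy : fl.leastSquares (reducedMatrix B J) (reducedRhs B J k) = some y) {m : Fin n → ℝ}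
    (hm : IsExactColumn B k J m) :
    norm2 (unitVec k - B.mulVec (extendBy J y)) ≤ norm2 (unitVec k - B.mulVec m) +
      408 * (n * (n * (n * u))) * dataSize B k (extendBy J y) +
      (200 * (n * (n * u))) ^ 2 * (L * ((3 * (1 + 6 * L / s) + L / s * (5 + 6 * L / s)) / s)) := by
  have hu := fl.unitRoundoff_nonneg
  have hn' : (1 : ℝ) ≤ n := by exact_mod_cast hn
  have he : 0 ≤ n * u := by positivity
  have hne : n * u ≤ n * (n * u) := by nlinarith
  obtain ⟨Q, R, c, hQ, hR, hres, -⟩ := fl.exists_leastSquares_spec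
    (Finset.card_le_univ (shadow B J) |>.trans_eq (Fintype.card_fin n))
    (Finset.card_le_univ J |>.trans_eq (Fintype.card_fin n)) hn h
    (reducedMatrix B J) (reducedRhs B J k)
  have h1 := hQ.norm2_headPart_le_of_abs_le (by positivity) (hres y hy)
  set b := reducedRhs B J k with hb
  set M := reducedMatrix B J with hM
  set x : Fin J.card → ℝ := fun i => m (J.orderEmbOfFin rfl i) with hx
  have hxm : extendBy J x = m := extendBy_restrict J hm.1
  set g := n * (n * u) with hg
  have hg0 : 0 ≤ g := by positivity
  have hD0 : 0 ≤ norm2 b + colWeight M y := add_nonneg (norm2_nonneg _) (colWeight_nonneg _ _)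
  have hhead : norm2 (headPart J.card (c - R.mulVec y)) ≤ 8 * g * (norm2 b + colWeight M y) := by
    have h6 : 6 * (n * u) * (1 + 200 * g) ≤ 8 * g := by nlinarith
    nlinarith [mul_le_mul_of_nonneg_right h6 hD0]
  have horth : ∀ z, M.mulVec z ⬝ᵥ (b - M.mulVec x) = 0 := by
    intro z
    have h2 := hm.orthogonal (w := extendBy J z) fun j hj => extendBy_of_notMem J z hj
    rw [← h2, ← hxm]
    refine Fintype.sum_of_injective ((shadow B J).orderEmbOfFin rfl)
      ((shadow B J).orderEmbOfFin rfl).injective _ _ (fun i hi => ?_) fun i => ?_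
    · have : i ∉ shadow B J := fun h => hi (exists_orderEmbOfFin_eq _ h)
      rw [mulVec_extendBy_of_notMem B J z this, zero_mul]
    · rw [Pi.sub_apply, Pi.sub_apply, mulVec_extendBy_apply, mulVec_extendBy_apply]
      rfl
  have hML : ∀ z, colWeight M z ≤ L * norm2 z := by
    intro z
    rw [← norm2_extendBy J z]
    exact (colWeight_reducedMatrix_le B J z).trans (hL _)
  have hMs : ∀ z, s * norm2 z ≤ norm2 (M.mulVec z) := by
    intro z
    rw [← norm2_extendBy J z, ← norm2_mulVec_extendBy]
    exact hBs _
  have hb1 : norm2 b ≤ 1 := (norm2_reducedRhs_le B J k).trans_eq (norm2_unitVec k)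
  have hdiff := hQ.norm2_sub_le_of_orthogonal (by positivity) (by linarith) hR horth
    (hhead.trans (mul_le_mul_of_nonneg_right (by linarith) hD0)) hb1 hs hL0 hMs hML hsmall
  set K := (3 * (1 + 6 * L / s) + L / s * (5 + 6 * L / s)) / s with hK
  have hres1 := hQ.norm2_residual_le_add hR x y
  have hcw := colWeight_le_add M x y
  have hdata : norm2 b + colWeight M y ≤ n * dataSize B k (extendBy J y) :=
    norm2_add_colWeight_reduced_le y
  have hcd : colWeight M (x - y) ≤ L * (200 * g * K) :=
    (hML _).trans (mul_le_mul_of_nonneg_left hdiff hL0)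
  have hred : norm2 (b - M.mulVec y) ≤ norm2 (b - M.mulVec x) +
      (408 * g * (norm2 b + colWeight M y) + 200 * g * colWeight M (x - y)) := by
    have h7 : 200 * g * (norm2 b + colWeight M x) ≤
        200 * g * (norm2 b + colWeight M y + colWeight M (x - y)) :=
      mul_le_mul_of_nonneg_left (by linarith) (by positivity)
    linarith
  have hfull := le_add_of_sq_eq_add (norm2_nonneg _)
    (add_nonneg (by positivity) (mul_nonneg (by positivity) (colWeight_nonneg _ _))) hred
    (norm2_sub_mulVec_extendBy_sq B J (unitVec k) y)
    (Finset.sum_nonneg fun i _ => sq_nonneg _) (norm2_nonneg _)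
    (norm2_sub_mulVec_extendBy_sq B J (unitVec k) x)
  rw [hxm] at hfull
  have h8 : 408 * g * (norm2 b + colWeight M y) ≤
      408 * g * (n * dataSize B k (extendBy J y)) := by gcongr
  have h9 : 200 * g * colWeight M (x - y) ≤ 200 * g * (L * (200 * g * K)) := by gcongr
  have h10 : 408 * g * (n * dataSize B k (extendBy J y)) =
    408 * (n * g) * dataSize B k (extendBy J y) := by ring
  have h11 : 200 * g * (L * (200 * g * K)) = (200 * g) ^ 2 * (L * K) := by ring
  linarith

end Column

/-! ### The condition number -/

section Cond

variable {n : ℕ}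

theorem norm2_mulVec_le_opNorm (W : Matrix (Fin n) (Fin n) ℝ) (v : Fin n → ℝ) :
    norm2 (W.mulVec v) ≤ ‖Matrix.toEuclideanCLM (n := Fin n) (𝕜 := ℝ) W‖ * norm2 v := by
  have h := (Matrix.toEuclideanCLM (n := Fin n) (𝕜 := ℝ) W).le_opNorm (WithLp.toLp 2 v)
  rwa [Matrix.toEuclideanCLM_toLp] at h

theorem opNorm_le_of_norm2_mulVec_le {W : Matrix (Fin n) (Fin n) ℝ} {a : ℝ} (ha : 0 ≤ a)
    (h : ∀ v, norm2 (W.mulVec v) ≤ a * norm2 v) :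
    ‖Matrix.toEuclideanCLM (n := Fin n) (𝕜 := ℝ) W‖ ≤ a := by
  refine ContinuousLinearMap.opNorm_le_bound _ ha fun v => ?_
  have h1 := h v.ofLp
  have h2 := Matrix.toEuclideanCLM_toLp (𝕜 := ℝ) W v.ofLp
  rw [WithLp.toLp_ofLp] at h2
  rw [h2]
  exact h1

theorem norm2_transpose_mulVec_le_opNorm (W : Matrix (Fin n) (Fin n) ℝ) (v : Fin n → ℝ) :
    norm2 (W.transpose.mulVec v) ≤
      ‖Matrix.toEuclideanCLM (n := Fin n) (𝕜 := ℝ) W‖ * norm2 v := by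
  set a := ‖Matrix.toEuclideanCLM (n := Fin n) (𝕜 := ℝ) W‖
  set y := W.transpose.mulVec v with hy
  have ha : 0 ≤ a := norm_nonneg _
  have h1 : norm2 y * norm2 y ≤ a * norm2 v * norm2 y := by
    calc norm2 y * norm2 y = y ⬝ᵥ y := by rw [← norm2_sq_eq_dotProduct, sq]
      _ = v ⬝ᵥ W.mulVec y := by
        rw [Matrix.dotProduct_mulVec v, ← Matrix.mulVec_transpose]
      _ ≤ norm2 v * norm2 (W.mulVec y) := dotProduct_le_norm2_mul _ _
      _ ≤ norm2 v * (a * norm2 y) :=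
        mul_le_mul_of_nonneg_left (norm2_mulVec_le_opNorm W y) (norm2_nonneg _)
      _ = _ := by ring
  rcases (norm2_nonneg y).eq_or_lt with h0 | h0
  · rw [← h0]
    exact mul_nonneg ha (norm2_nonneg _)
  · exact le_of_mul_le_mul_right h1 h0

theorem norm2_mulVec_sq_le (V : Matrix (Fin n) (Fin n) ℝ) (v : Fin n → ℝ) :
    norm2 (V.mulVec v) ^ 2 ≤ (∑ i, ∑ j, V i j ^ 2) * norm2 v ^ 2 := by
  rw [norm2_sq, norm2_sq, Finset.sum_mul]
  exact Finset.sum_le_sum fun i _ => Finset.sum_mul_sq_le_sq_mul_sq Finset.univ (V i) v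

theorem sum_sq_le_card_mul_opNorm_sq (W : Matrix (Fin n) (Fin n) ℝ) :
    ∑ i, ∑ j, W i j ^ 2 ≤ n * ‖Matrix.toEuclideanCLM (n := Fin n) (𝕜 := ℝ) W‖ ^ 2 := by
  rw [Finset.sum_comm]
  have h : ∀ j, ∑ i, W i j ^ 2 ≤ ‖Matrix.toEuclideanCLM (n := Fin n) (𝕜 := ℝ) W‖ ^ 2 := by
    intro j
    have h1 := norm2_mulVec_le_opNorm W (unitVec j)
    have h2 : W.mulVec (unitVec j) = fun i => W i j := by
      funext i
      simp [unitVec]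
    rw [norm2_unitVec, mul_one, h2] at h1
    rw [← norm2_sq]
    exact pow_le_pow_left₀ (norm2_nonneg _) h1 2
  calc ∑ j, ∑ i, W i j ^ 2
      ≤ ∑ _j : Fin n, ‖Matrix.toEuclideanCLM (n := Fin n) (𝕜 := ℝ) W‖ ^ 2 :=
        Finset.sum_le_sum fun j _ => h j
    _ = _ := by simp

theorem absMat_transpose (A : Matrix (Fin n) (Fin n) ℝ) :
    absMat A.transpose = (absMat A).transpose := rfl

theorem absMat_mul_absMat_inv_transpose (A : Matrix (Fin n) (Fin n) ℝ) :
    absMat A.transpose * absMat A.transpose⁻¹ = (absMat A⁻¹ * absMat A).transpose := by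
  rw [Matrix.transpose_mul, ← absMat_transpose, ← absMat_transpose, Matrix.transpose_nonsing_inv]

theorem mul_mulVec_eq_self {B C : Matrix (Fin n) (Fin n) ℝ} (h : B * C = 1) (w : Fin n → ℝ) :
    B.mulVec (C.mulVec w) = w := by
  rw [Matrix.mulVec_mulVec, h, Matrix.one_mulVec]

theorem abs_mulVec_le (B : Matrix (Fin n) (Fin n) ℝ) (w : Fin n → ℝ) (i : Fin n) :
    |B.mulVec w i| ≤ (absMat B).mulVec (absVec w) i :=
  (Finset.abs_sum_le_sum_abs (fun j => B i j * w j) Finset.univ).trans_eq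
    (Finset.sum_congr rfl fun _ _ => abs_mul _ _)

/-- `cond₂(A)` controls the growth from `Aᵀ w` to `|Aᵀ| |w|`, as `|w| ≤ |A⁻ᵀ| |Aᵀ w|`. -/
theorem norm2_absMat_mulVec_le_cond2 {A : Matrix (Fin n) (Fin n) ℝ} (hA : IsUnit A.det)
    (w : Fin n → ℝ) :
    norm2 ((absMat A.transpose).mulVec (absVec w)) ≤
      cond2 A * norm2 (A.transpose.mulVec w) := by
  set B := A.transpose with hB
  have hBd : IsUnit B.det := by rwa [hB, Matrix.det_transpose]
  have hw := mul_mulVec_eq_self (Matrix.nonsing_inv_mul B hBd) w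
  have h1 : norm2 ((absMat B).mulVec (absVec w)) ≤
      norm2 ((absMat A⁻¹ * absMat A).transpose.mulVec (absVec (B.mulVec w))) := by
    rw [← absMat_mul_absMat_inv_transpose, ← Matrix.mulVec_mulVec]
    refine norm2_le_norm2 fun i => ?_
    rw [abs_of_nonneg (absMat_mulVec_absVec_nonneg B w i)]
    refine le_trans ?_ (le_abs_self _)
    change ∑ j, |B i j| * |w j| ≤ ∑ j, |B i j| * (absMat B⁻¹).mulVec (absVec (B.mulVec w)) j
    refine Finset.sum_le_sum fun j _ => mul_le_mul_of_nonneg_left ?_ (abs_nonneg _)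
    have := abs_mulVec_le B⁻¹ (B.mulVec w) j
    rwa [hw] at this
  refine h1.trans ((norm2_transpose_mulVec_le_opNorm _ _).trans_eq ?_)
  rw [norm2_absVec]
  rfl

theorem one_le_cond2 {A : Matrix (Fin n) (Fin n) ℝ} (hA : IsUnit A.det) (k : Fin n) :
    1 ≤ cond2 A := by
  have h1 := norm2_mulVec_le_opNorm (absMat A⁻¹ * absMat A) (unitVec k)
  rw [norm2_unitVec, mul_one] at h1
  refine le_trans ?_ ((abs_le_norm2 _ k).trans h1)
  have h2 : (absMat A⁻¹ * absMat A).mulVec (unitVec k) k = (absMat A⁻¹ * absMat A) k k := by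
    simp [unitVec]
  have h3 : (A⁻¹ * A) k k = 1 := by rw [Matrix.nonsing_inv_mul A hA, Matrix.one_apply_eq]
  rw [h2]
  refine le_trans ?_ (le_abs_self _)
  calc (1 : ℝ) = |(A⁻¹ * A) k k| := by rw [h3, abs_one]
    _ ≤ ∑ j, |A⁻¹ k j * A j k| :=
        Finset.abs_sum_le_sum_abs (fun j => A⁻¹ k j * A j k) Finset.univ
    _ = _ := Finset.sum_congr rfl fun j _ => abs_mul _ _

/-- If the columns of `A` have comparable norms, the condition number of `A` is bounded by that of
its transpose. The bound goes through Frobenius norms: the entry `(i, j)` of `|A⁻¹| |A|` is at most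
`σ` times the product of the norms of row `i` of `A⁻¹` and column `i` of `A`, and the entries of
this outer product are dominated by those of `|A| |A⁻¹|`. -/
theorem cond2_le_mul_cond2_transpose (A : Matrix (Fin n) (Fin n) ℝ) {σ : ℝ} (hσ0 : 0 ≤ σ)
    (hσ : ∀ i j, norm2 (fun r => A r i) ≤ σ * norm2 fun r => A r j) :
    cond2 A ≤ n * σ * cond2 A.transpose := by
  set X := A⁻¹ with hX
  set κ := cond2 A.transpose with hκd
  have hκ0 : 0 ≤ κ := norm_nonneg _
  set U := absMat A * absMat X with hU
  have hκ : ∑ l, ∑ k, U l k ^ 2 ≤ n * κ ^ 2 := by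
    have h1 := sum_sq_le_card_mul_opNorm_sq (absMat A.transpose⁻¹ * absMat A.transpose)
    rw [← Matrix.transpose_nonsing_inv, absMat_transpose, absMat_transpose,
      ← Matrix.transpose_mul, ← hX, ← hU, Finset.sum_comm] at h1
    refine h1.trans_eq ?_
    rw [hκd, cond2, ← Matrix.transpose_nonsing_inv, absMat_transpose, absMat_transpose,
      ← Matrix.transpose_mul, ← hX, ← hU]
  set V := absMat X * absMat A with hV
  have hVij : ∀ i j, V i j ^ 2 ≤ σ ^ 2 * ∑ l, ∑ k, (A l i * X i k) ^ 2 := by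
    intro i j
    have h1 : V i j ≤ norm2 (X i) * norm2 (fun r => A r j) := sum_mul_le_norm2_mul _ _
    have h2 : 0 ≤ V i j := by
      change 0 ≤ ∑ k, |X i k| * |A k j|
      positivity
    have h3 : V i j ≤ σ * (norm2 (fun r => A r i) * norm2 (X i)) := by
      refine h1.trans ((mul_le_mul_of_nonneg_left (hσ j i) (norm2_nonneg _)).trans_eq ?_)
      ring
    refine (pow_le_pow_left₀ h2 h3 2).trans_eq ?_
    rw [mul_pow, mul_pow, norm2_sq, norm2_sq, Finset.sum_mul_sum]
    simp only [mul_pow]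
  have hsum : ∑ i, ∑ l, ∑ k, (A l i * X i k) ^ 2 ≤ ∑ l, ∑ k, U l k ^ 2 := by
    rw [Finset.sum_comm]
    refine Finset.sum_le_sum fun l _ => ?_
    rw [Finset.sum_comm]
    refine Finset.sum_le_sum fun k _ => ?_
    calc ∑ i, (A l i * X i k) ^ 2 = ∑ i, (|A l i| * |X i k|) ^ 2 := by
          refine Finset.sum_congr rfl fun i _ => ?_
          rw [← abs_mul, sq_abs]
      _ ≤ (∑ i, |A l i| * |X i k|) ^ 2 :=
          Finset.sum_sq_le_sq_sum_of_nonneg fun i _ => by positivity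
      _ = _ := rfl
  have hVF : ∑ i, ∑ j, V i j ^ 2 ≤ (n * σ * κ) ^ 2 := by
    calc ∑ i, ∑ j, V i j ^ 2
        ≤ ∑ i, ∑ _j : Fin n, σ ^ 2 * ∑ l, ∑ k, (A l i * X i k) ^ 2 :=
          Finset.sum_le_sum fun i _ => Finset.sum_le_sum fun j _ => hVij i j
      _ = n * σ ^ 2 * ∑ i, ∑ l, ∑ k, (A l i * X i k) ^ 2 := by
          simp only [Finset.sum_const, Finset.card_univ, Fintype.card_fin, nsmul_eq_mul]
          rw [Finset.mul_sum]
          exact Finset.sum_congr rfl fun i _ => by ring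
      _ ≤ n * σ ^ 2 * (n * κ ^ 2) :=
          mul_le_mul_of_nonneg_left (hsum.trans hκ) (by positivity)
      _ = _ := by ring
  have h0 : 0 ≤ n * σ * κ := by positivity
  refine opNorm_le_of_norm2_mulVec_le h0 fun v => ?_
  apply le_of_sq_le_sq _ (mul_nonneg h0 (norm2_nonneg v))
  rw [mul_pow]
  exact (norm2_mulVec_sq_le V v).trans (mul_le_mul_of_nonneg_right hVF (sq_nonneg _))

/-! ### Nonsingular matrices and the exact solution -/

theorem shadow_univ_eq_univ {B : Matrix (Fin n) (Fin n) ℝ} (hB : IsUnit B.det) :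
    shadow B Finset.univ = Finset.univ := by
  refine Finset.eq_univ_of_forall fun i => ?_
  simp only [shadow, Finset.mem_filter, Finset.mem_univ, true_and]
  intro h
  rw [Finset.sum_eq_zero_iff_of_nonneg fun j _ => abs_nonneg _] at h
  refine hB.ne_zero (Matrix.det_eq_zero_of_row_eq_zero i fun j => ?_)
  exact abs_eq_zero.mp (h j (Finset.mem_univ j))

theorem exists_pos_mul_norm2_le {B : Matrix (Fin n) (Fin n) ℝ} (hB : IsUnit B.det) :
    ∃ s : ℝ, 0 < s ∧ ∀ w, s * norm2 w ≤ norm2 (B.mulVec w) := by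
  set L := ∑ j, norm2 (fun i => B⁻¹ i j) with hL
  have hL0 : 0 ≤ L := Finset.sum_nonneg fun j _ => norm2_nonneg _
  refine ⟨1 / (L + 1), by positivity, fun w => ?_⟩
  have h1 := (norm2_mulVec_le_colWeight B⁻¹ (B.mulVec w)).trans
    (colWeight_le_mul_norm2 B⁻¹ (B.mulVec w))
  rw [mul_mulVec_eq_self (Matrix.nonsing_inv_mul B hB) w, ← hL] at h1
  rw [one_div_mul_eq_div, div_le_iff₀ (by positivity)]
  linarith [norm2_nonneg (B.mulVec w)]

theorem IsExactColumn.residual_eq_zero {B : Matrix (Fin n) (Fin n) ℝ} (hB : IsUnit B.det)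
    {k : Fin n} {m : Fin n → ℝ} (hm : IsExactColumn B k Finset.univ m) :
    unitVec k - B.mulVec m = 0 := by
  have h1 := hm.2 (B⁻¹.mulVec (unitVec k)) fun j hj => absurd (Finset.mem_univ j) hj
  rw [mul_mulVec_eq_self (Matrix.mul_nonsing_inv B hB), sub_self, norm2_zero] at h1
  exact eq_zero_of_norm2_eq_zero (le_antisymm h1 (norm2_nonneg _))

/-- A column with a small residual relative to its data size has a data size of order `κ`. -/
theorem dataSize_le_of_residual_le {B : Matrix (Fin n) (Fin n) ℝ} {k : Fin n} {κ τ : ℝ}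
    (hκ1 : 1 ≤ κ) (hκ : ∀ w, norm2 ((absMat B).mulVec (absVec w)) ≤ κ * norm2 (B.mulVec w))
    {m : Fin n → ℝ} (hm : norm2 (unitVec k - B.mulVec m) ≤ τ * dataSize B k m)
    (hτ : τ * κ ≤ 1 / 2) : dataSize B k m ≤ 4 * κ := by
  have h1 : norm2 (B.mulVec m) ≤ 1 + τ * dataSize B k m := by
    calc norm2 (B.mulVec m) = norm2 (unitVec k - (unitVec k - B.mulVec m)) := by
          rw [sub_sub_cancel]
      _ ≤ norm2 (unitVec k) + norm2 (unitVec k - B.mulVec m) := norm2_sub_le _ _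
      _ ≤ _ := by rw [norm2_unitVec]; linarith
  have h2 : dataSize B k m ≤ 1 + κ * norm2 (B.mulVec m) := by
    refine (norm2_add_le _ _).trans ?_
    rw [norm2_absVec, norm2_unitVec]
    exact add_le_add le_rfl (hκ m)
  have h3 := dataSize_nonneg B k m
  nlinarith [mul_le_mul_of_nonneg_right hτ h3]

end Cond

/-! ### Residual bounds for the computed columns -/

theorem le_gammaTilde {c u : ℝ} {n : ℕ} (h0 : 0 ≤ c * n * u) (h1 : c * n * u < 1) :
    c * n * u ≤ gammaTilde c u n := by
  rw [gammaTilde, le_div_iff₀ (by linarith)]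
  nlinarith

theorem gammaTilde_le {c u : ℝ} {n : ℕ} (h0 : 0 ≤ c * n * u) (h1 : c * n * u ≤ 1 / 2) :
    gammaTilde c u n ≤ 2 * (c * n * u) := by
  rw [gammaTilde, div_le_iff₀ (by linarith)]
  nlinarith

/-- A strictly growing sequence of patterns reaches the full pattern after at most `n` steps. -/
theorem exists_eq_univ_of_ssubset {n : ℕ} (J : ℕ → Finset (Fin n))
    (hJ : ∀ t, J t ≠ Finset.univ → J t ⊂ J (t + 1)) : ∃ t ≤ n, J t = Finset.univ := by
  by_contra! h
  have hcard : ∀ t ≤ n + 1, t ≤ (J t).card := by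
    intro t
    induction t with
    | zero => simp
    | succ t ih =>
      intro ht
      have h1 := Finset.card_lt_card (hJ t (h t (by omega)))
      have h2 := ih (by omega)
      omega
  have h1 := hcard (n + 1) le_rfl
  have h2 := Finset.card_le_univ (J (n + 1))
  rw [Fintype.card_fin] at h2
  omega

section Bounds

variable {n : ℕ} {A : Matrix (Fin n) (Fin n) ℝ}

/-- The residual bound for arbitrary patterns. The term with `cond₂(A) ‖r_k‖` is not needed: the
error terms are already bounded by the data size and a second order remainder. -/
theorem exists_residual_bound (hA : IsUnit A.det) :
    ∃ K u₀ : ℝ, 0 < u₀ ∧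
      ∀ (u : ℝ) (fl : FloatArith u), u ≤ u₀ → ∀ (k : Fin n) (J : Finset (Fin n)),
        ∃ mh : Fin n → ℝ, spaiColumn fl A.transpose k J = some mh ∧
          ∀ m : Fin n → ℝ, IsExactColumn A.transpose k J m →
            norm2 (spaiResidual fl A.transpose k mh) ≤
              (n : ℝ) ^ 2 * gammaTilde 1000 u n * dataSize A.transpose k mh
                + (1 + (n : ℝ) ^ 2 * gammaTilde 1000 u n * cond2 A)
                    * norm2 (unitVec k - A.transpose.mulVec m)
                + K * u ^ 2 := by
  have hκ0 : 0 ≤ cond2 A := norm_nonneg _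
  have hκ := norm2_absMat_mulVec_le_cond2 hA
  set B := A.transpose with hB
  have hBd : IsUnit B.det := by rwa [hB, Matrix.det_transpose]
  obtain ⟨s, hs, hBs⟩ := exists_pos_mul_norm2_le hBd
  have hL := colWeight_le_mul_norm2 B
  have hL0 : 0 ≤ ∑ j, norm2 fun i => B i j := Finset.sum_nonneg fun j _ => norm2_nonneg _
  set L := ∑ j, norm2 fun i => B i j
  have hN : (0 : ℝ) ≤ n := Nat.cast_nonneg n
  -- `T` dominates the factors of `u` in all the smallness conditions on `u`
  set T : ℝ := 1 + n + n * n + n * (n * n) * cond2 A + n * n * L with hT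
  have ha1 : 0 ≤ (n : ℝ) * n := by positivity
  have ha2 : 0 ≤ n * (n * n) * cond2 A := by positivity
  have ha3 : 0 ≤ n * n * L := by positivity
  have hT0 : 0 < T := by linarith
  refine ⟨(200 * (n * n)) ^ 2 * (L * ((3 * (1 + 6 * L / s) + L / s * (5 + 6 * L / s)) / s)),
    min s 1 / (10000 * T), by positivity, fun u fl hu0 k J => ?_⟩
  have hu := fl.unitRoundoff_nonneg
  have hn : 1 ≤ n := k.pos
  have hn' : (1 : ℝ) ≤ n := by exact_mod_cast hn
  rw [le_div_iff₀ (by positivity)] at hu0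
  have hus := hu0.trans (min_le_left _ _)
  have hu1 := hu0.trans (min_le_right _ _)
  have hb : ∀ a, a ≤ T → 10000 * (a * u) ≤ u * (10000 * T) := by
    intro a ha
    nlinarith
  have h1 := hb n (by linarith)
  have h2 := hb (n * n) (by linarith)
  have h3 := hb (n * (n * n) * cond2 A) (by linarith)
  have h4 := hb (n * n * L) (by linarith)
  have h : n * (n * u) ≤ 1 / 1000 := by linarith
  obtain ⟨y, hy, hmh⟩ := exists_spaiColumn_eq_some fl B J k hn h hκ
    (fun w hw => by
      rw [← mul_mulVec_eq_self (Matrix.nonsing_inv_mul B hBd) w, hw, Matrix.mulVec_zero])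
    (by linarith)
  refine ⟨extendBy J y, hmh, fun m hm => ?_⟩
  have h5 := norm2_sub_mulVec_le fl hn h hs hL hL0 hBs (by linarith) hy hm
  have h6 := norm2_spaiResidual_le fl hn (by linarith) B k (extendBy J y)
  have hg : 1000 * n * u ≤ gammaTilde 1000 u n := le_gammaTilde (by positivity) (by linarith)
  set γ := gammaTilde 1000 u n
  have hγ0 : 0 ≤ γ := le_trans (by positivity) hg
  have hD := dataSize_nonneg B k (extendBy J y)
  set D := dataSize B k (extendBy J y)
  have hr := norm2_nonneg (unitVec k - B.mulVec m)
  set r := norm2 (unitVec k - B.mulVec m)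
  have h7 : 0 ≤ (n : ℝ) ^ 2 * γ * cond2 A * r := by positivity
  have h8 : 408 * (n * (n * (n * u))) * D + 6 * (n * u) * D ≤ (n : ℝ) ^ 2 * γ * D := by
    have h9 : n * u ≤ n * (n * (n * u)) := by
      have : 0 ≤ n * u := by positivity
      nlinarith [mul_le_mul hn' hn' zero_le_one hN]
    have h10 : (n : ℝ) ^ 2 * (1000 * n * u) ≤ (n : ℝ) ^ 2 * γ := by gcongr
    have h11 : (n : ℝ) ^ 2 * (1000 * n * u) = 1000 * (n * (n * (n * u))) := by ring
    have h12 : 0 ≤ n * (n * (n * u)) := by positivity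
    rw [← add_mul]
    exact mul_le_mul_of_nonneg_right (by linarith) hD
  have h13 : (200 * (n * (n * u))) ^ 2 *
      (L * ((3 * (1 + 6 * L / s) + L / s * (5 + 6 * L / s)) / s)) =
      (200 * (n * n)) ^ 2 *
        (L * ((3 * (1 + 6 * L / s) + L / s * (5 + 6 * L / s)) / s)) * u ^ 2 := by ring
  rw [h13] at h5
  linarith

theorem norm2_spaiResidual_le_of_univ (hA : IsUnit A.det) {u : ℝ} (fl : FloatArith u)
    (hu1 : 1000 * (n : ℝ) ^ 2 * u < 1) {k : Fin n} {mh : Fin n → ℝ}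
    (hmh : spaiColumn fl A.transpose k Finset.univ = some mh) :
    norm2 (spaiResidual fl A.transpose k mh) ≤
      (n : ℝ) ^ 2 * gammaTilde 1000 u n * dataSize A.transpose k mh := by
  have hu := fl.unitRoundoff_nonneg
  have hn : 1 ≤ n := k.pos
  have hn' : (1 : ℝ) ≤ n := by exact_mod_cast hn
  have hnu : 0 ≤ n * u := by positivity
  have h : n * (n * u) ≤ 1 / 1000 := by linarith
  have h1 : n * u ≤ n * (n * u) := by nlinarith
  have h2 := norm2_sub_mulVec_le_of_univ fl hn h
    (shadow_univ_eq_univ (by rwa [Matrix.det_transpose])) hmh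
  have h3 := norm2_spaiResidual_le fl hn (by linarith) A.transpose k mh
  have hg : 1000 * n * u ≤ gammaTilde 1000 u n := le_gammaTilde (by positivity) (by linarith)
  have h4 : n * u ≤ n * (n * (n * u)) := by nlinarith
  have h5 : (n : ℝ) ^ 2 * (1000 * n * u) ≤ (n : ℝ) ^ 2 * gammaTilde 1000 u n := by gcongr
  have h6 : (208 * (n * (n * (n * u))) + 6 * (n * u)) * dataSize A.transpose k mh ≤
      (n : ℝ) ^ 2 * gammaTilde 1000 u n * dataSize A.transpose k mh :=
    mul_le_mul_of_nonneg_right (by linarith) (dataSize_nonneg _ _ _)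
  linarith

theorem exists_column_of_cond2_le (hA : IsUnit A.det) {u : ℝ} (fl : FloatArith u) (k : Fin n)
    {ε : ℝ} (hε : 8000 * (n : ℝ) ^ 3 * (u * cond2 A) ≤ min ε 1) :
    ∃ mh : Fin n → ℝ, spaiColumn fl A.transpose k Finset.univ = some mh ∧
      1000 * (n : ℝ) ^ 2 * u < 1 ∧
      (n : ℝ) ^ 2 * gammaTilde 1000 u n * dataSize A.transpose k mh ≤ ε := by
  have hu := fl.unitRoundoff_nonneg
  have hn : 1 ≤ n := k.pos
  have hn' : (1 : ℝ) ≤ n := by exact_mod_cast hn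
  have hκ1 := one_le_cond2 hA k
  have hκ := norm2_absMat_mulVec_le_cond2 hA
  have hBd : IsUnit A.transpose.det := by rwa [Matrix.det_transpose]
  set κ := cond2 A
  have hε1 := hε.trans (min_le_right _ _)
  have hεε := hε.trans (min_le_left _ _)
  have hnu : 0 ≤ n * u := by positivity
  have h1 : n * u ≤ n * (n * u) := by nlinarith
  have h2 : n * (n * u) ≤ n * (n * (n * u)) := by nlinarith
  have h3 : n * (n * (n * u)) ≤ n * (n * (n * u)) * κ :=
    le_mul_of_one_le_right (by positivity) hκ1
  have h4 : 8000 * (n : ℝ) ^ 3 * (u * κ) = 8000 * (n * (n * (n * u)) * κ) := by ring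
  rw [h4] at hε1 hεε
  have h : n * (n * u) ≤ 1 / 1000 := by linarith
  obtain ⟨y, -, hmh⟩ := exists_spaiColumn_eq_some fl A.transpose Finset.univ k hn h hκ
    (fun w hw => by
      rw [← mul_mulVec_eq_self (Matrix.nonsing_inv_mul A.transpose hBd) w, hw,
        Matrix.mulVec_zero])
    (by linarith)
  refine ⟨_, hmh, by linarith, ?_⟩
  have h5 := norm2_sub_mulVec_le_of_univ fl hn h (shadow_univ_eq_univ hBd) hmh
  have h6 := dataSize_le_of_residual_le hκ1 hκ h5 (by linarith)
  have h7 : gammaTilde 1000 u n ≤ 2 * (1000 * n * u) :=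
    gammaTilde_le (by positivity) (by linarith)
  calc (n : ℝ) ^ 2 * gammaTilde 1000 u n * dataSize A.transpose k (extendBy Finset.univ y)
      ≤ (n : ℝ) ^ 2 * (2 * (1000 * n * u)) * (4 * κ) := by
        refine mul_le_mul (mul_le_mul_of_nonneg_left h7 (by positivity)) h6
          (dataSize_nonneg _ _ _) (by positivity)
    _ = 8000 * (n * (n * (n * u)) * κ) := by ring
    _ ≤ ε := hεε

theorem one_le_of_norm2_col_le (hA : IsUnit A.det) (k : Fin n) {σ : ℝ}
    (hσ : ∀ i j, norm2 (fun r => A r i) ≤ σ * norm2 fun r => A r j) : 1 ≤ σ := by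
  have h1 : norm2 (fun r => A r k) ≠ 0 := fun h => hA.ne_zero
    (Matrix.det_eq_zero_of_column_eq_zero k (congrFun (eq_zero_of_norm2_eq_zero h)))
  have h2 := (norm2_nonneg _).lt_of_ne' h1
  have h3 := hσ k k
  by_contra! hlt
  nlinarith

end Bounds

theorem mainTheorem2 :
    ∃ c C : ℝ, 0 < c ∧ 0 < C ∧
      ∀ (n : ℕ) (A : Matrix (Fin n) (Fin n) ℝ), IsUnit A.det →
        -- arbitrary pattern: residual bound up to second order terms
        (∃ K u₀ : ℝ, 0 < u₀ ∧
          ∀ (u : ℝ) (fl : FloatArith u), u ≤ u₀ → ∀ (k : Fin n) (J : Finset (Fin n)),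
            ∃ mh : Fin n → ℝ, spaiColumn fl A.transpose k J = some mh ∧
              ∀ m : Fin n → ℝ, IsExactColumn A.transpose k J m →
                norm2 (spaiResidual fl A.transpose k mh) ≤
                  (n : ℝ) ^ 2 * gammaTilde c u n * dataSize A.transpose k mh
                    + (1 + (n : ℝ) ^ 2 * gammaTilde c u n * cond2 A)
                        * norm2 (unitVec k - A.transpose.mulVec m)
                    + K * u ^ 2) ∧
        -- full pattern: the exact residual is zero
        (∀ (k : Fin n) (m : Fin n → ℝ), IsExactColumn A.transpose k Finset.univ m →
          unitVec k - A.transpose.mulVec m = 0) ∧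
        -- full pattern: residual bound, and attainability of the stopping criterion
        (∀ (u : ℝ) (fl : FloatArith u), c * (n : ℝ) ^ 2 * u < 1 → ∀ (k : Fin n) (mh : Fin n → ℝ),
          spaiColumn fl A.transpose k Finset.univ = some mh →
            norm2 (spaiResidual fl A.transpose k mh) ≤
                (n : ℝ) ^ 2 * gammaTilde c u n * dataSize A.transpose k mh ∧
            ∀ ε : ℝ, 0 < ε →
              (n : ℝ) ^ 2 * gammaTilde c u n * dataSize A.transpose k mh ≤ ε →
                norm2 (spaiResidual fl A.transpose k mh) ≤ ε ∧
                ∀ J : ℕ → Finset (Fin n), (∀ t, J t ≠ Finset.univ → J t ⊂ J (t + 1)) →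
                  ∃ t ≤ n, ∃ mt : Fin n → ℝ, spaiColumn fl A.transpose k (J t) = some mt ∧
                    norm2 (spaiResidual fl A.transpose k mt) ≤ ε) ∧
        -- a priori conditions on the unit roundoff
        (∀ (u : ℝ) (fl : FloatArith u) (k : Fin n) (ε : ℝ), 0 < ε →
          (C * (n : ℝ) ^ 3 * (u * cond2 A) ≤ min ε 1 ∨
            ∃ σ : ℝ, (∀ i j, norm2 (fun r => A r i) ≤ σ * norm2 (fun r => A r j)) ∧
              C * (n : ℝ) ^ 4 * σ * (u * cond2 A.transpose) ≤ min ε 1) →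
          ∃ mh : Fin n → ℝ, spaiColumn fl A.transpose k Finset.univ = some mh ∧
            c * (n : ℝ) ^ 2 * u < 1 ∧
            (n : ℝ) ^ 2 * gammaTilde c u n * dataSize A.transpose k mh ≤ ε ∧
            norm2 (spaiResidual fl A.transpose k mh) ≤ ε) := by

  -- `c = 1000` makes `c n² u < 1` imply `n² u ≤ 1/1000`; as `γ̃ ≤ 2 c n u` and the data size is at
  -- most `4 cond₂(A)`, the a priori condition needs `C = 8 c`
  refine ⟨1000, 8000, by norm_num, by norm_num, fun n A hA => ⟨exists_residual_bound hA,
    fun k m hm => hm.residual_eq_zero (by rwa [Matrix.det_transpose]), ?_, ?_⟩⟩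
  · intro u fl hu k mh hmh
    have h1 := norm2_spaiResidual_le_of_univ hA fl hu hmh
    refine ⟨h1, fun ε _ hε => ⟨h1.trans hε, fun J hJ => ?_⟩⟩
    obtain ⟨t, ht, htJ⟩ := exists_eq_univ_of_ssubset J hJ
    exact ⟨t, ht, mh, by rw [htJ, hmh], h1.trans hε⟩
  · intro u fl k ε _ h
    have hcond : 8000 * (n : ℝ) ^ 3 * (u * cond2 A) ≤ min ε 1 := by
      rcases h with h | ⟨σ, hσ, h⟩
      · exact h
      · have hu := fl.unitRoundoff_nonneg
        have hσ1 := one_le_of_norm2_col_le hA k hσ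
        have h1 := cond2_le_mul_cond2_transpose A (by linarith) hσ
        calc 8000 * (n : ℝ) ^ 3 * (u * cond2 A)
            ≤ 8000 * (n : ℝ) ^ 3 * (u * (n * σ * cond2 A.transpose)) := by gcongr
          _ = 8000 * (n : ℝ) ^ 4 * σ * (u * cond2 A.transpose) := by ring
          _ ≤ min ε 1 := h
    obtain ⟨mh, hmh, hu, hε⟩ := exists_column_of_cond2_le hA fl k hcond
    exact ⟨mh, hmh, hu, hε, (norm2_spaiResidual_le_of_univ hA fl hu hmh).trans hε⟩
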